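/- Let $R$ be a commutative ring with identity and let $A$ be a free $R$-module of finite rank. The nearly $2$-dimensional cobordism category $\mathbf{N2Cob}$ has as objects the non-empty closed oriented $1$-manifolds, and as morphisms the oriented cobordisms, up to diffeomorphism relative to the boundary, each of whose components has no critical points of index $0$ or $2$ (equivalently, has non-empty incoming and non-empty outgoing boundary). An almost 2D-TQFT with value $A$ on the circle is a symmetric monoidal functor $\mathcal F^a$ from $\mathbf{N2Cob}$ to $R$-modules that sends $\sqcup_m S^1$ to $A^{\otimes m}$ and disjoint unions of cobordisms to tensor products of maps. The corresponding nearly Frobenius algebra is $(A,m,\Delta)$, where $m:A\otimes A\to A$ and $\Delta:A\to A\otimes A$ are the images of the pairs of pants that merge two circles and split one circle, respectively. For a link diagram $D$ with ordered crossings $c_1,\dots,c_n$, each state $s\in\{0,1\}^n$ gives, by choosing the corresponding resolution of each crossing, a disjoint union of circles $\Gamma_s$; let $|s|$ be the number of $1$'s in $s$. If $s_2$ arises from $s_1$ by changing one entry from $0$ to $1$, let $W_{s_1}^{s_2}:\Gamma_{s_1}\to\Gamma_{s_2}$ be the saddle cobordism at that crossing (with cylinders over the other circles), and let $\langle s_1,s_2\rangle$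 be the number of $1$'s in $s_1$ before that entry. Put $$C^i(D;\mathcal F^a)=\bigoplus_{|s|=i}\mathcal F^a(\Gamma_s),\qquad d^i=\sum_{|s_1|=i}(-1)^{\langle s_1,s_2\rangle}\mathcal F^a(W_{s_1}^{s_2}),\qquad H^i(D;\mathcal F^a)=\ker d^i/\operatorname{im}d^{i-1}.$$ Suppose that this homology is invariant under the second Reidemeister move up to a shift of degree: whenever link diagrams $D$ and $D'$ differ by one second Reidemeister move, there is $k\in\mathbb Z$ such that $H^i(D;\mathcal F^a)\cong H^{i+k}(D';\mathcal F^a)$ as $R$-modules for all $i\in\mathbb Z$. Then the corresponding nearly Frobenius algebra $(A,m,\Delta)$ is a (commutative) Frobenius algebra, that is, besides being commutative, associative, cocommutative, coassociative and satisfying the Frobenius relation, it has a unit and a counit. In particular, $m$ is surjective and $\Delta$ is injective; moreover, if $A\neq 0$, then $A$ has rank $2$. -/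

import Mathlib

open scoped TensorProduct

noncomputable section

/-! ## Nearly two-dimensional cobordisms

A non-empty closed oriented 1-manifold is, up to diffeomorphism, a non-empty finite disjoint union
of circles, so it is given by its finite non-empty set of circles.  A compact oriented surface with
parametrised boundary is determined, up to diffeomorphism relative to the boundary, by its set of
connected components, the component on which each boundary circle lies, and the genus of each
component. -/

/-- A cobordism from a disjoint union of circles indexed by `I` to one indexed by `J`, each of whose
components has a non-empty incoming and a non-empty outgoing boundary, equivalently, which can be
built without critical points of index `0` and `2`. -/
structure Cob (I J : Type) where
  /-- the connected components of the surface -/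
  Comp : Type
  /-- the component on which an incoming circle lies -/
  inn : I → Comp
  /-- the component on which an outgoing circle lies -/
  out : J → Comp
  inn_surjective : Function.Surjective inn
  out_surjective : Function.Surjective out
  /-- the genus of each component -/
  genus : Comp → ℕ

namespace Cob

/-- Two cobordisms are diffeomorphic relative to their boundary. -/
def Diffeo {I J : Type} (V W : Cob I J) : Prop :=
  ∃ e : V.Comp ≃ W.Comp, (∀ i, e (V.inn i) = W.inn i) ∧ (∀ j, e (V.out j) = W.out j) ∧
    ∀ c, W.genus (e c) = V.genus c

/-- The cylinders that connect each circle `i` with the circle `e i`. For `e` the identity this is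
the identity cobordism, for a permutation of two circles it is the twist. -/
def cylinder {I J : Type} (e : I ≃ J) : Cob I J where
  Comp := J
  inn := e
  out := id
  inn_surjective := e.surjective
  out_surjective := Function.surjective_id
  genus := fun _ => 0

/-- Disjoint union of cobordisms. -/
def disjUnion {I J I' J' : Type} (V : Cob I J) (W : Cob I' J') : Cob (I ⊕ I') (J ⊕ J') where
  Comp := V.Comp ⊕ W.Comp
  inn := Sum.map V.inn W.inn
  out := Sum.map V.out W.out
  inn_surjective := V.inn_surjective.sumMap W.inn_surjective
  out_surjective := V.out_surjective.sumMap W.out_surjective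
  genus := Sum.elim V.genus W.genus

/-- Two pieces, one of `V` and one of `W`, are glued along a circle `j`. -/
def Glued {I J K : Type} (V : Cob I J) (W : Cob J K) (x y : V.Comp ⊕ W.Comp) : Prop :=
  ∃ j, x = Sum.inl (V.out j) ∧ y = Sum.inr (W.inn j)

/-- The component of the glued surface on which a piece lies. -/
def glue {I J K : Type} (V : Cob I J) (W : Cob J K) (x : V.Comp ⊕ W.Comp) :
    Quot (Glued V W) := Quot.mk _ x

/-- Gluing `V` and `W` (first `V`, then `W`) along the circles `J`.  A component of the result is a
connected graph of pieces, with one edge for each circle of `J` on it; its genus is the sum of the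
genera of the pieces plus the first Betti number `#edges + 1 - #pieces` of this graph. -/
def comp {I J K : Type} (V : Cob I J) (W : Cob J K) : Cob I K where
  Comp := Quot (Glued V W)
  inn := fun i => glue V W (Sum.inl (V.inn i))
  out := fun k => glue V W (Sum.inr (W.out k))
  inn_surjective := by
    rintro ⟨x | y⟩
    · obtain ⟨i, rfl⟩ := V.inn_surjective x
      exact ⟨i, rfl⟩
    · obtain ⟨j, rfl⟩ := W.inn_surjective y
      obtain ⟨i, hi⟩ := V.inn_surjective (V.out j)
      exact ⟨i, (congrArg (fun c => glue V W (Sum.inl c)) hi).trans (Quot.sound ⟨j, rfl, rfl⟩)⟩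
  out_surjective := by
    rintro ⟨x | y⟩
    · obtain ⟨j, rfl⟩ := V.out_surjective x
      obtain ⟨k, hk⟩ := W.out_surjective (W.inn j)
      exact ⟨k, (congrArg (fun c => glue V W (Sum.inr c)) hk).trans (Quot.sound ⟨j, rfl, rfl⟩).symm⟩
    · obtain ⟨k, rfl⟩ := W.out_surjective y
      exact ⟨k, rfl⟩
  genus := fun c =>
    (∑ᶠ x : {x : V.Comp ⊕ W.Comp // glue V W x = c}, Sum.elim V.genus W.genus x.1) +
      (Nat.card {j : J // glue V W (Sum.inl (V.out j)) = c} + 1 -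
        Nat.card {x : V.Comp ⊕ W.Comp // glue V W x = c})

/-- The pair of pants that merges two circles into one. -/
def mergePants : Cob (Unit ⊕ Unit) Unit where
  Comp := Unit
  inn := fun _ => ()
  out := fun _ => ()
  inn_surjective := fun _ => ⟨Sum.inl (), rfl⟩
  out_surjective := fun _ => ⟨(), rfl⟩
  genus := fun _ => 0

/-- The pair of pants that splits one circle into two. -/
def splitPants : Cob Unit (Unit ⊕ Unit) where
  Comp := Unit
  inn := fun _ => ()
  out := fun _ => ()
  inn_surjective := fun _ => ⟨(), rfl⟩
  out_surjective := fun _ => ⟨Sum.inl (), rfl⟩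
  genus := fun _ => 0

end Cob

/-- An almost 2D-TQFT over `R` with value `A` on the circle: a symmetric monoidal functor from the
nearly two-dimensional cobordism category to `R`-modules that sends a disjoint union of circles
indexed by `I` to the tensor power `⨂_I A`. The field `map_cylinder` contains the preservation of
identities and of the symmetry. -/
structure AlmostTQFT (R : Type*) [CommRing R] (A : Type*) [AddCommGroup A] [Module R A] where
  map : ∀ {I J : Type} [Finite I] [Nonempty I] [Finite J] [Nonempty J],
    Cob I J → (⨂[R] _ : I, A) →ₗ[R] (⨂[R] _ : J, A)
  map_congr : ∀ {I J : Type} [Finite I] [Nonempty I] [Finite J] [Nonempty J]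
    (V W : Cob I J), V.Diffeo W → map V = map W
  map_cylinder : ∀ {I J : Type} [Finite I] [Nonempty I] [Finite J] [Nonempty J] (e : I ≃ J),
    map (Cob.cylinder e) = (PiTensorProduct.reindex R (fun _ : I => A) e).toLinearMap
  map_comp : ∀ {I J K : Type} [Finite I] [Nonempty I] [Finite J] [Nonempty J] [Finite K]
    [Nonempty K] (V : Cob I J) (W : Cob J K), map (V.comp W) = map W ∘ₗ map V
  map_disjUnion : ∀ {I J I' J' : Type} [Finite I] [Nonempty I] [Finite J] [Nonempty J]
    [Finite I'] [Nonempty I'] [Finite J'] [Nonempty J'] (V : Cob I J) (W : Cob I' J'),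
    map (V.disjUnion W) =
      (PiTensorProduct.tmulEquiv R A).toLinearMap ∘ₗ TensorProduct.map (map V) (map W) ∘ₗ
        (PiTensorProduct.tmulEquiv R A).symm.toLinearMap

namespace AlmostTQFT

variable {R : Type*} [CommRing R] {A : Type*} [AddCommGroup A] [Module R A]

variable (R A) in
/-- The value `⨂_{circle} A` on one circle is `A`. -/
def oneCircle : (⨂[R] _ : Unit, A) ≃ₗ[R] A := PiTensorProduct.subsingletonEquiv ()

variable (R A) in
/-- The value on two circles is `A ⊗ A`. -/
def twoCircles : (⨂[R] _ : Unit ⊕ Unit, A) ≃ₗ[R] A ⊗[R] A :=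
  (PiTensorProduct.tmulEquiv R A).symm ≪≫ₗ TensorProduct.congr (oneCircle R A) (oneCircle R A)

/-- The multiplication of the nearly Frobenius algebra corresponding to an almost 2D-TQFT. -/
def mul (F : AlmostTQFT R A) : A ⊗[R] A →ₗ[R] A :=
  (oneCircle R A).toLinearMap ∘ₗ F.map Cob.mergePants ∘ₗ (twoCircles R A).symm.toLinearMap

/-- The comultiplication of the nearly Frobenius algebra corresponding to an almost 2D-TQFT. -/
def comul (F : AlmostTQFT R A) : A →ₗ[R] A ⊗[R] A :=
  (twoCircles R A).toLinearMap ∘ₗ F.map Cob.splitPants ∘ₗ (oneCircle R A).symm.toLinearMap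

end AlmostTQFT

/-! ## Nearly Frobenius algebras and Frobenius algebras -/

/-- `m` and `Δ` make `A` a (commutative) nearly Frobenius algebra. -/
structure IsNearlyFrobenius (R : Type*) [CommRing R] {A : Type*} [AddCommGroup A] [Module R A]
    (m : A ⊗[R] A →ₗ[R] A) (Δ : A →ₗ[R] A ⊗[R] A) : Prop where
  mul_assoc : ∀ x y z : A, m (m (x ⊗ₜ y) ⊗ₜ z) = m (x ⊗ₜ m (y ⊗ₜ z))
  mul_comm : ∀ x y : A, m (x ⊗ₜ y) = m (y ⊗ₜ x)
  coassoc : ∀ x : A, TensorProduct.assoc R A A A (Δ.rTensor A (Δ x)) = Δ.lTensor A (Δ x)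
  cocomm : ∀ x : A, TensorProduct.comm R A A (Δ x) = Δ x
  /-- `Δ ∘ m = (id ⊗ m) ∘ (Δ ⊗ id)` -/
  frobenius_left : ∀ x y : A,
    Δ (m (x ⊗ₜ y)) = m.lTensor A (TensorProduct.assoc R A A A (Δ x ⊗ₜ y))
  /-- `Δ ∘ m = (m ⊗ id) ∘ (id ⊗ Δ)` -/
  frobenius_right : ∀ x y : A,
    Δ (m (x ⊗ₜ y)) = m.rTensor A ((TensorProduct.assoc R A A A).symm (x ⊗ₜ Δ y))

/-- `m` and `Δ` make `A` a (commutative) Frobenius algebra: a nearly Frobenius algebra that has a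
unit and a counit. -/
structure IsFrobenius (R : Type*) [CommRing R] {A : Type*} [AddCommGroup A] [Module R A]
    (m : A ⊗[R] A →ₗ[R] A) (Δ : A →ₗ[R] A ⊗[R] A) : Prop extends IsNearlyFrobenius R m Δ where
  exists_unit : ∃ u : A, ∀ x : A, m (u ⊗ₜ x) = x ∧ m (x ⊗ₜ u) = x
  exists_counit : ∃ ε : A →ₗ[R] R, ∀ x : A,
    TensorProduct.lid R A (ε.rTensor A (Δ x)) = x ∧ TensorProduct.rid R A (ε.lTensor A (Δ x)) = x

/-! ## Link diagrams

A link diagram is cut by horizontal lines into elementary slices, each with one cup, cap or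
crossing, the other strands being vertical. Slices are read from bottom to top, strands are
numbered `0, 1, …` from left to right. Every planar link diagram is planar isotopic to such a
one. -/

/-- The elementary slices. -/
inductive Slice where
  /-- `∪`: two new strands, at the positions `i`, `i + 1` above the slice -/
  | cup (i : ℕ)
  /-- `∩`: the strands at the positions `i`, `i + 1` below the slice end -/
  | cap (i : ℕ)
  /-- a crossing of the strands `i`, `i + 1`; the strand that runs like `/` passes over -/
  | slash (i : ℕ)
  /-- a crossing of the strands `i`, `i + 1`; the strand that runs like `\` passes over -/
  | backslash (i : ℕ)

namespace Slice

/-- The slice can be placed above `n` strands. -/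
def Fits (n : ℕ) : Slice → Prop
  | cup i => i ≤ n
  | cap i => i + 2 ≤ n
  | slash i => i + 2 ≤ n
  | backslash i => i + 2 ≤ n

/-- The number of strands above the slice, if there are `n` strands below it. -/
def width (n : ℕ) : Slice → ℕ
  | cup _ => n + 2
  | cap _ => n - 2
  | slash _ => n
  | backslash _ => n

def isCrossing : Slice → Bool
  | cup _ => false
  | cap _ => false
  | slash _ => true
  | backslash _ => true

/-- All strands between the heights `k` and `k + 1` are vertical, in particular the crossing is
replaced by `)(`. The point `(k, j)` is that of the `j`-th strand at height `k`. -/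
def VerticalArc (k : ℕ) (p q : ℕ × ℕ) : Prop :=
  ∃ j, p = (k, j) ∧ q = (k + 1, j)

/-- The arcs `∩` below `∪` at the positions `i`, `i + 1`, the other strands being vertical. -/
def HorizontalArc (k i : ℕ) (p q : ℕ × ℕ) : Prop :=
  (p = (k, i) ∧ q = (k, i + 1)) ∨ (p = (k + 1, i) ∧ q = (k + 1, i + 1)) ∨
    ∃ j, j ≠ i ∧ j ≠ i + 1 ∧ p = (k, j) ∧ q = (k + 1, j)

/-- `p` and `q` are the two ends of an arc of the slice between the heights `k` and `k + 1`, after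
its crossing, if any, has been replaced by the `0`-resolution (`b = false`) or the `1`-resolution
(`b = true`). -/
def Arc (b : Bool) (k : ℕ) : Slice → ℕ × ℕ → ℕ × ℕ → Prop
  | cup i, p, q => (p = (k + 1, i) ∧ q = (k + 1, i + 1)) ∨
      ∃ j, p = (k, j) ∧ q = (k + 1, if j < i then j else j + 2)
  | cap i, p, q => (p = (k, i) ∧ q = (k, i + 1)) ∨
      ∃ j, p = (k, if j < i then j else j + 2) ∧ q = (k + 1, j)
  | slash i, p, q => if b then HorizontalArc k i p q else VerticalArc k p q
  | backslash i, p, q => if b then VerticalArc k p q else HorizontalArc k i p q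

end Slice

/-- The number of strands above the first `k` slices of a word that starts with no strands. -/
def strands (w : List Slice) (k : ℕ) : ℕ := (w.take k).foldl Slice.width 0

/-- A (non-empty, unoriented) link diagram. -/
structure LinkDiagram where
  /-- the slices, from bottom to top -/
  word : List Slice
  fits : ∀ k : Fin word.length, (word.get k).Fits (strands word k)
  closed : strands word word.length = 0
  ne_nil : word ≠ []

namespace LinkDiagram

/-- The intersection points of the diagram with the horizontal lines. -/
abbrev Point (D : LinkDiagram) : Type :=
  Σ k : Fin (D.word.length + 1), Fin (strands D.word k)

/-- The crossings, which are ordered by their height. -/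
abbrev Crossing (D : LinkDiagram) : Type :=
  {k : Fin D.word.length // (D.word.get k).isCrossing = true}

/-- A state chooses the `0`-resolution (`false`) or the `1`-resolution (`true`) at each crossing. -/
abbrev State (D : LinkDiagram) : Type := D.Crossing → Bool

/-- The number of `1`-resolutions in a state. -/
def weight (D : LinkDiagram) (s : D.State) : ℕ :=
  (Finset.univ.filter fun c : D.Crossing => s c = true).card

/-- The points `p` and `q` are the ends of an arc of the diagram resolved according to `s`. -/
def Arc (D : LinkDiagram) (s : D.State) (p q : D.Point) : Prop :=
  ∃ k : Fin D.word.length,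
    (D.word.get k).Arc (if h : (D.word.get k).isCrossing = true then s ⟨k, h⟩ else false) k
      ((p.1 : ℕ), (p.2 : ℕ)) ((q.1 : ℕ), (q.2 : ℕ))

/-- The points `p` and `q` lie on the same circle of the resolved diagram. -/
def circleSetoid (D : LinkDiagram) (s : D.State) : Setoid D.Point :=
  Relation.EqvGen.setoid (D.Arc s)

/-- The circles of the diagram resolved according to `s`. -/
abbrev Circles (D : LinkDiagram) (s : D.State) : Type := Quotient (D.circleSetoid s)

instance (D : LinkDiagram) (s : D.State) : Nonempty (D.Circles s) := by
  obtain ⟨w, hf, hc, hn⟩ := D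
  match w, hn with
  | x :: w, _ =>
    have h0 := hf ⟨0, by simp⟩
    have h1 : 0 < strands (x :: w) 1 := by
      cases x <;> simp_all [strands, Slice.Fits, Slice.width]
    exact ⟨Quotient.mk _ ⟨⟨1, by simp⟩, ⟨0, h1⟩⟩⟩

/-- The cobordism from the circles of `s` to the circles of `t`, where `t` arises from `s` by the
change of one crossing from its `0`- to its `1`-resolution: a saddle near this crossing and a
cylinder over every circle away from it. Circles on the same component are those connected through
common points; a component is a cylinder or a pair of pants, hence of genus `0`. -/
def saddle (D : LinkDiagram) (s t : D.State) : Cob (D.Circles s) (D.Circles t) where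
  Comp := Quotient (D.circleSetoid s ⊔ D.circleSetoid t)
  inn := Quotient.map' id fun _ _ h => Setoid.le_def.1 le_sup_left h
  out := Quotient.map' id fun _ _ h => Setoid.le_def.1 le_sup_right h
  inn_surjective := by
    rintro ⟨p⟩
    exact ⟨Quotient.mk _ p, rfl⟩
  out_surjective := by
    rintro ⟨p⟩
    exact ⟨Quotient.mk _ p, rfl⟩
  genus := fun _ => 0

variable {R : Type*} [CommRing R] {A : Type*} [AddCommGroup A] [Module R A]

/-- The chain module `C^i(D; F)`, the direct sum over the states with `i` many `1`-resolutions of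
the modules `F(Γ_s) = ⨂_{Γ_s} A`. It is zero if there are no such states. -/
abbrev Chain (D : LinkDiagram) (_F : AlmostTQFT R A) (i : ℤ) : Type _ :=
  ∀ s : {s : D.State // (D.weight s : ℤ) = i}, ⨂[R] _ : D.Circles s.1, A

open Classical in
/-- The differential from `C^i(D; F)` to `C^j(D; F)`, of interest for `j = i + 1` (and zero
otherwise): the sum over the states `s` of degree `i` and the crossings `c` with `0`-resolution in
`s` of the map induced by the saddle at `c`, with the sign `(-1)^n`, where `n` is the number of
`1`-resolutions of `s` before `c`. -/
def diff (D : LinkDiagram) (F : AlmostTQFT R A) (i j : ℤ) : D.Chain F i →ₗ[R] D.Chain F j :=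
  LinearMap.pi fun t => ∑ s : {s : D.State // (D.weight s : ℤ) = i}, ∑ c : D.Crossing,
    if s.1 c = false ∧ t.1 = Function.update s.1 c true then
      (-1 : R) ^ (Finset.univ.filter fun c' : D.Crossing => c' < c ∧ s.1 c' = true).card •
        (F.map (D.saddle s.1 t.1) ∘ₗ LinearMap.proj s)
    else 0

/-- The diagram homology `H^i(D; F) = ker d^i / im d^{i-1}`. -/
abbrev Homology (D : LinkDiagram) (F : AlmostTQFT R A) (i : ℤ) : Type _ :=
  LinearMap.ker (D.diff F i (i + 1)) ⧸
    (LinearMap.range (D.diff F (i - 1) i)).submoduleOf (LinearMap.ker (D.diff F i (i + 1)))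

/-- `D'` arises from `D` by a second Reidemeister move that slides one of two neighbouring vertical
strands over the other. -/
def ReidemeisterII (D D' : LinkDiagram) : Prop :=
  ∃ (u v : List Slice) (i : ℕ), D.word = u ++ v ∧
    (D'.word = u ++ [Slice.slash i, Slice.backslash i] ++ v ∨
      D'.word = u ++ [Slice.backslash i, Slice.slash i] ++ v)

end LinkDiagram

/-- The diagram homology induced by `F` is, up to a shift of the degree, invariant under the second
Reidemeister move. -/
def AlmostTQFT.IsInvariantRII {R : Type*} [CommRing R] {A : Type*} [AddCommGroup A] [Module R A]
    (F : AlmostTQFT R A) : Prop :=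
  ∀ D D' : LinkDiagram, D.ReidemeisterII D' →
    ∃ k : ℤ, ∀ i : ℤ, Nonempty (D.Homology F i ≃ₗ[R] D'.Homology F (i + k))

end

/-! The nearly Frobenius relations hold for every almost 2D-TQFT. In each relation both sides come
from gluings that are connected of genus `0`, and such a cobordism is determined by its boundary
(`comp_diffeo_sphere`).

Invariance is used for a single move: two disjoint circles become two overlapping ones. The first
diagram has no crossings, so its homology is `A ⊗ A` in one degree. The states of the second have 1,
2, 2, 1 circles, and up to isomorphism its complex is `A → (A ⊗ A)² → A` with `d⁰ a = (Δ a, Δ a)`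
and `d¹ (y, z) = m z - m y`. By invariance its homology is `A ⊗ A` in a single degree `k`. Let `n >
0` be the rank of `A`. All modules involved are projective, so the complex splits and ranks can be
compared. For `k = 0` or `k = 2` this gives `3n² = 2n`, for `k` outside the complex `n² = 0`; both
are impossible. Hence `k = 1` and `2n² = n² + 2n`, so `n = 2`. Moreover `d¹` is surjective and `d⁰`
is split injective, so `m` is surjective and `Δ` has a linear retraction (`split_of_isInvariantRII`,
`surjective_mul_and_exists_retraction_comul`).

The unit comes from a Nakayama-type fact (`exists_unit_of_span_mul_eq_top`): in the unitization of
`A` the ideal `A` is finitely generated and, as `m` is surjective, idempotent, so it is generated by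
an idempotent, which is a unit of `A`. The counit is obtained from the same fact for the dual `A*`
with the convolution product: the retraction of `Δ` makes this product surjective, and a unit of
`A*` is a counit of `A`. -/

/-! ### Units of non-unital commutative algebras. -/

/-- A finitely generated commutative non-unital algebra that is spanned by its products has a
unit. -/
theorem exists_unit_of_span_mul_eq_top {R A : Type*} [CommRing R] [AddCommGroup A] [Module R A]
    [Module.Finite R A] (μ : A →ₗ[R] A →ₗ[R] A) (hassoc : ∀ x y z, μ (μ x y) z = μ x (μ y z))
    (hcomm : ∀ x y, μ x y = μ y x)
    (hspan : Submodule.span R (Set.range fun p : A × A => μ p.1 p.2) = ⊤) :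
    ∃ u, ∀ x, μ u x = x := by
  let _ : NonUnitalCommRing A :=
    { ‹AddCommGroup A› with
      mul := fun x y => μ x y
      left_distrib := fun x y z => (μ x).map_add y z
      right_distrib := fun x y z => LinearMap.map_add₂ μ x y z
      zero_mul := fun x => LinearMap.map_zero₂ μ x
      mul_zero := fun x => (μ x).map_zero
      mul_assoc := hassoc
      mul_comm := hcomm }
  have mul_def : ∀ x y : A, x * y = μ x y := fun _ _ => rfl
  have : IsScalarTower R A A := ⟨fun r x y => by simp [mul_def]⟩
  have : SMulCommClass R A A := ⟨fun r x y => by simp [mul_def]⟩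
  -- The augmentation ideal of the unitization is a copy of `A`. Generators of the module `A`
  -- generate it as an ideal, and it equals its square because products span `A`.
  let I : Ideal (Unitization R A) := RingHom.ker (Unitization.fstHom R A)
  have mem_I : ∀ a : A, (a : Unitization R A) ∈ I := fun a => by simp [I, RingHom.mem_ker]
  have of_mem_I : ∀ x ∈ I, x = (x.snd : Unitization R A) := fun x hx => by
    have : x.fst = 0 := by simpa [I, RingHom.mem_ker] using hx
    ext <;> simp [this]
  have inr_smul : ∀ (r : R) (a : A), ((r • a : A) : Unitization R A) =
      algebraMap R (Unitization R A) r * (a : Unitization R A) := fun r a => by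
    rw [← Algebra.smul_def, Unitization.inr_smul]
  have hfg : I.FG := by
    obtain ⟨S, hS⟩ := (Module.Finite.fg_top : (⊤ : Submodule R A).FG)
    refine ⟨S.map ⟨Unitization.inr, Unitization.inr_injective (R := R)⟩, le_antisymm ?_ ?_⟩
    · rw [Submodule.span_le]
      intro x hx
      obtain ⟨a, -, rfl⟩ := by simpa using hx
      exact mem_I a
    · intro x hx
      rw [of_mem_I x hx]
      have : x.snd ∈ Submodule.span R (S : Set A) := hS ▸ Submodule.mem_top
      generalize x.snd = y at this
      induction this using Submodule.span_induction with
      | mem a ha => exact Submodule.subset_span (by simpa using ha)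
      | zero => simp
      | add a b _ _ iha ihb => rw [Unitization.inr_add]; exact add_mem iha ihb
      | smul r a _ iha => rw [inr_smul]; exact Ideal.mul_mem_left _ _ iha
  have hidem : IsIdempotentElem I := by
    refine le_antisymm Ideal.mul_le_right fun x hx => ?_
    rw [of_mem_I x hx]
    have : x.snd ∈ Submodule.span R (Set.range fun p : A × A => μ p.1 p.2) :=
      hspan ▸ Submodule.mem_top
    generalize x.snd = y at this
    induction this using Submodule.span_induction with
    | mem a ha =>
      obtain ⟨p, rfl⟩ := ha
      have : ((μ p.1 p.2 : A) : Unitization R A) = (p.1 : Unitization R A) * p.2 := by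
        rw [← mul_def, Unitization.inr_mul]
      rw [this]
      exact Ideal.mul_mem_mul (mem_I _) (mem_I _)
    | zero => simp
    | add a b _ _ iha ihb => rw [Unitization.inr_add]; exact add_mem iha ihb
    | smul r a _ iha => rw [inr_smul]; exact Ideal.mul_mem_left _ _ iha
  -- A finitely generated idempotent ideal is generated by an idempotent `e`. Each `x` in it is a
  -- multiple of `e`, hence `e * x = x`.
  obtain ⟨e, he, hI⟩ := (Ideal.isIdempotentElem_iff_of_fg I hfg).1 hidem
  have heI : e ∈ I := hI ▸ Ideal.mem_span_singleton_self e
  refine ⟨e.snd, fun x => ?_⟩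
  obtain ⟨y, hy⟩ := Ideal.mem_span_singleton'.1 (hI ▸ mem_I x)
  have : e * (x : Unitization R A) = x := by rw [← hy, mul_left_comm, he.eq]
  rw [of_mem_I e heI, ← Unitization.inr_mul] at this
  exact Unitization.inr_injective this

/-! ### Unit and counit of a nearly Frobenius algebra. -/

section Frobenius

variable {R A : Type*} [CommRing R] [AddCommGroup A] [Module R A] {m : A ⊗[R] A →ₗ[R] A}
  {Δ : A →ₗ[R] A ⊗[R] A}

theorem IsNearlyFrobenius.exists_unit [Module.Finite R A] (h : IsNearlyFrobenius R m Δ)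
    (hm : Function.Surjective m) : ∃ u : A, ∀ x : A, m (u ⊗ₜ x) = x ∧ m (x ⊗ₜ u) = x := by
  obtain ⟨u, hu⟩ := exists_unit_of_span_mul_eq_top (TensorProduct.curry m)
    (fun x y z => by simpa using h.mul_assoc x y z) (fun x y => by simpa using h.mul_comm x y) <| by
      rw [eq_top_iff]
      rintro x -
      obtain ⟨t, rfl⟩ := hm x
      induction t with
      | zero => simp
      | tmul a b => exact Submodule.subset_span ⟨(a, b), rfl⟩
      | add a b ha hb => rw [map_add]; exact add_mem ha hb
  exact ⟨u, fun x => ⟨hu x, (h.mul_comm x u).trans (hu x)⟩⟩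

/-- The convolution product on the dual of a coalgebra. -/
noncomputable def dualMul (Δ : A →ₗ[R] A ⊗[R] A) :
    Module.Dual R A →ₗ[R] Module.Dual R A →ₗ[R] Module.Dual R A :=
  (TensorProduct.mk R (Module.Dual R A) (Module.Dual R A)).compr₂
    (LinearMap.lcomp R R Δ ∘ₗ TensorProduct.dualDistrib R A A)

theorem dualMul_apply (f g : Module.Dual R A) :
    dualMul Δ f g = LinearMap.mul' R R ∘ₗ TensorProduct.map f g ∘ₗ Δ := rfl

theorem dualMul_apply_left (f g : Module.Dual R A) (x : A) :
    dualMul Δ f g x = g (TensorProduct.lid R A (f.rTensor A (Δ x))) := by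
  rw [dualMul_apply]
  simp only [LinearMap.comp_apply]
  generalize Δ x = t
  induction t with
  | zero => simp
  | tmul a b => simp
  | add a b ha hb => simp only [map_add, ha, hb]

theorem dualMul_apply_right (f g : Module.Dual R A) (x : A) :
    dualMul Δ f g x = f (TensorProduct.rid R A (g.lTensor A (Δ x))) := by
  rw [dualMul_apply]
  simp only [LinearMap.comp_apply]
  generalize Δ x = t
  induction t with
  | zero => simp
  | tmul a b => simp [mul_comm]
  | add a b ha hb => simp only [map_add, ha, hb]

theorem IsNearlyFrobenius.dualMul_comm (h : IsNearlyFrobenius R m Δ) (f g : Module.Dual R A) :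
    dualMul Δ f g = dualMul Δ g f := by
  ext x
  rw [dualMul_apply, dualMul_apply]
  simp only [LinearMap.comp_apply]
  conv_lhs => rw [← h.cocomm x]
  generalize Δ x = t
  induction t with
  | zero => simp
  | tmul a b => simp [_root_.mul_comm]
  | add a b ha hb => simp only [map_add, ha, hb]

/-- Both sides apply `f ⊗ g ⊗ k` to an iterated coproduct of `x`, so this is dual to
coassociativity. -/
theorem IsNearlyFrobenius.dualMul_assoc (h : IsNearlyFrobenius R m Δ) (f g k : Module.Dual R A) :
    dualMul Δ (dualMul Δ f g) k = dualMul Δ f (dualMul Δ g k) := by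
  have h1 : ∀ t : A ⊗[R] A, LinearMap.mul' R R (TensorProduct.map (dualMul Δ f g) k t) =
      LinearMap.mul' R R (TensorProduct.map f (LinearMap.mul' R R ∘ₗ TensorProduct.map g k)
        (TensorProduct.assoc R A A A (Δ.rTensor A t))) := fun t => by
    induction t with
    | zero => simp
    | tmul a b =>
      simp only [TensorProduct.map_tmul, LinearMap.rTensor_tmul, dualMul_apply,
        LinearMap.comp_apply]
      generalize Δ a = t
      induction t with
      | zero => simp
      | tmul a b => simp [_root_.mul_assoc]
      | add a b ha hb =>
        simp only [map_add, TensorProduct.add_tmul, ha, hb]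
    | add a b ha hb => simp only [map_add, ha, hb]
  have h2 : ∀ t : A ⊗[R] A, LinearMap.mul' R R (TensorProduct.map f (dualMul Δ g k) t) =
      LinearMap.mul' R R (TensorProduct.map f (LinearMap.mul' R R ∘ₗ TensorProduct.map g k)
        (Δ.lTensor A t)) := fun t => by
    induction t with
    | zero => simp
    | tmul a b => simp [dualMul_apply]
    | add a b ha hb => simp only [map_add, ha, hb]
  ext x
  change LinearMap.mul' R R (TensorProduct.map (dualMul Δ f g) k (Δ x)) =
    LinearMap.mul' R R (TensorProduct.map f (dualMul Δ g k) (Δ x))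
  rw [h1, h2, h.coassoc]

/-- A unit for convolution on the dual is a counit. Since `A` is finite free, `A* ⊗ A*` is all of
`(A ⊗ A)*`, so the convolution product is the transpose of `Δ`, which is surjective as soon as `Δ`
has a retraction. -/
theorem IsNearlyFrobenius.exists_counit [Module.Finite R A] [Module.Free R A]
    (h : IsNearlyFrobenius R m Δ) (r : A ⊗[R] A →ₗ[R] A) (hr : r ∘ₗ Δ = LinearMap.id) :
    ∃ ε : A →ₗ[R] R, ∀ x : A, TensorProduct.lid R A (ε.rTensor A (Δ x)) = x ∧
      TensorProduct.rid R A (ε.lTensor A (Δ x)) = x := by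
  obtain ⟨ε, hε⟩ := exists_unit_of_span_mul_eq_top (dualMul Δ) h.dualMul_assoc h.dualMul_comm <| by
    rw [eq_top_iff]
    rintro f -
    -- The functional `f ∘ r` on `A ⊗ A` restricts along `Δ` to `f`; written as a sum of pure
    -- tensors it exhibits `f` as a sum of convolution products.
    obtain ⟨t, ht⟩ := (TensorProduct.dualDistribEquiv R A A).surjective (f ∘ₗ r)
    have hf : f = LinearMap.lcomp R R Δ (TensorProduct.dualDistrib R A A t) := by
      have : TensorProduct.dualDistrib R A A t = f ∘ₗ r := ht
      rw [this]
      change f = f ∘ₗ (r ∘ₗ Δ)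
      rw [hr, LinearMap.comp_id]
    rw [hf]
    clear ht hf
    induction t with
    | zero => simp
    | tmul a b => exact Submodule.subset_span ⟨(a, b), rfl⟩
    | add a b ha hb => rw [map_add, map_add]; exact add_mem ha hb
  refine ⟨ε, fun x => ⟨?_, ?_⟩⟩
  -- Functionals separate the points of the free module `A`, so it is enough to test the counit law
  -- against every `f`, where it is the unit law of convolution.
  · refine (Module.forall_dual_apply_eq_zero_iff R _).1 ?_ |> sub_eq_zero.1
    intro f
    rw [map_sub, ← dualMul_apply_left, hε, sub_self]
  · refine (Module.forall_dual_apply_eq_zero_iff R _).1 ?_ |> sub_eq_zero.1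
    intro f
    rw [map_sub, ← dualMul_apply_right, h.dualMul_comm, hε, sub_self]

end Frobenius

/-! ### Connected cobordisms of genus zero. -/

namespace Cob

variable {I J K : Type}

/-- The connected cobordism of genus `0`. -/
def sphere (I J : Type) [Nonempty I] [Nonempty J] : Cob I J where
  Comp := Unit
  inn := fun _ => ()
  out := fun _ => ()
  inn_surjective := fun _ => ⟨Classical.arbitrary I, rfl⟩
  out_surjective := fun _ => ⟨Classical.arbitrary J, rfl⟩
  genus := fun _ => 0

theorem Diffeo.symm {V W : Cob I J} (h : V.Diffeo W) : W.Diffeo V := by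
  obtain ⟨e, h1, h2, h3⟩ := h
  refine ⟨e.symm, fun i => ?_, fun j => ?_, fun c => ?_⟩
  · rw [← h1, e.symm_apply_apply]
  · rw [← h2, e.symm_apply_apply]
  · rw [← h3, e.apply_symm_apply]

theorem diffeo_sphere [Nonempty I] [Nonempty J] (V : Cob I J) [Subsingleton V.Comp]
    (hV : ∀ c, V.genus c = 0) : V.Diffeo (sphere I J) := by
  let _ : Unique V.Comp := uniqueOfSubsingleton (V.inn (Classical.arbitrary I))
  exact ⟨Equiv.equivPUnit V.Comp, fun _ => rfl, fun _ => rfl, fun c => (hV c).symm⟩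

/-- When the glued surface is connected, the bound `hcard` says that the graph of pieces has first
Betti number `0`, so gluing pieces of genus `0` creates no genus. -/
theorem comp_diffeo_sphere [Nonempty I] [Nonempty K] [Finite J] (V : Cob I J) (W : Cob J K)
    [Finite V.Comp] [Finite W.Comp] (hV : ∀ c, V.genus c = 0) (hW : ∀ c, W.genus c = 0)
    [hs : Subsingleton (V.comp W).Comp] (hcard : Nat.card J + 1 ≤ Nat.card V.Comp + Nat.card W.Comp) :
    (V.comp W).Diffeo (sphere I K) := by
  refine diffeo_sphere _ fun c => ?_
  have hs' : ∀ x, glue V W x = c := fun x => hs.elim _ _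
  have h1 : Nat.card {j : J // glue V W (Sum.inl (V.out j)) = c} = Nat.card J :=
    Nat.card_congr (Equiv.subtypeUnivEquiv fun _ => hs' _)
  have h2 : Nat.card {x : V.Comp ⊕ W.Comp // glue V W x = c} =
      Nat.card V.Comp + Nat.card W.Comp := by
    rw [Nat.card_congr (Equiv.subtypeUnivEquiv hs'), Nat.card_sum]
  change (∑ᶠ x : {x : V.Comp ⊕ W.Comp // glue V W x = c}, Sum.elim V.genus W.genus x.1) +
      (Nat.card {j : J // glue V W (Sum.inl (V.out j)) = c} + 1 -
        Nat.card {x : V.Comp ⊕ W.Comp // glue V W x = c}) = 0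
  rw [h1, h2, Nat.sub_eq_zero_of_le hcard, add_zero]
  refine finsum_eq_zero_of_forall_eq_zero fun x => ?_
  rcases x with ⟨x | x, -⟩
  · exact hV x
  · exact hW x

theorem subsingleton_comp_right (V : Cob I J) (W : Cob J K) [Subsingleton W.Comp] [Nonempty K] :
    Subsingleton (V.comp W).Comp := by
  have key : ∀ q : (V.comp W).Comp,
      q = glue V W (Sum.inr (W.out (Classical.arbitrary K))) := by
    rintro ⟨x | x⟩
    · obtain ⟨j, rfl⟩ := V.out_surjective x
      exact (Quot.sound ⟨j, rfl, rfl⟩).trans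
        (congrArg (fun c => glue V W (Sum.inr c)) (Subsingleton.elim _ _))
    · exact congrArg (fun c => glue V W (Sum.inr c)) (Subsingleton.elim _ _)
  exact ⟨fun a b => (key a).trans (key b).symm⟩

theorem subsingleton_comp_left (V : Cob I J) (W : Cob J K) [Subsingleton V.Comp] [Nonempty I] :
    Subsingleton (V.comp W).Comp := by
  have key : ∀ q : (V.comp W).Comp,
      q = glue V W (Sum.inl (V.inn (Classical.arbitrary I))) := by
    rintro ⟨x | x⟩
    · exact congrArg (fun c => glue V W (Sum.inl c)) (Subsingleton.elim _ _)
    · obtain ⟨j, rfl⟩ := W.inn_surjective x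
      exact (Quot.sound ⟨j, rfl, rfl⟩).symm.trans
        (congrArg (fun c => glue V W (Sum.inl c)) (Subsingleton.elim _ _))
  exact ⟨fun a b => (key a).trans (key b).symm⟩

theorem cylinder_comp_sphere [Finite J] [Nonempty I] [Nonempty J] [Nonempty K] (e : I ≃ J) :
    ((cylinder e).comp (sphere J K)).Diffeo (sphere I K) := by
  have : Subsingleton (sphere J K).Comp := inferInstanceAs (Subsingleton Unit)
  have : Finite (cylinder e).Comp := ‹Finite J›
  have := subsingleton_comp_right (cylinder e) (sphere J K)
  refine comp_diffeo_sphere _ _ (fun _ => rfl) (fun _ => rfl) ?_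
  change _ ≤ Nat.card J + Nat.card Unit
  simp

theorem sphere_comp_cylinder [Finite J] [Nonempty I] [Nonempty J] [Nonempty K] (e : J ≃ K) :
    ((sphere I J).comp (cylinder e)).Diffeo (sphere I K) := by
  have : Subsingleton (sphere I J).Comp := inferInstanceAs (Subsingleton Unit)
  have : Finite (cylinder e).Comp := Finite.of_equiv J e
  have := subsingleton_comp_left (sphere I J) (cylinder e)
  refine comp_diffeo_sphere _ _ (fun _ => rfl) (fun _ => rfl) ?_
  change _ ≤ Nat.card Unit + Nat.card K
  simp [Nat.card_congr e, add_comm]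

/-- The cobordism `V` with renamed outgoing circles. -/
def relabelOut (V : Cob I J) (e : J ≃ K) : Cob I K where
  Comp := V.Comp
  inn := V.inn
  out := V.out ∘ e.symm
  inn_surjective := V.inn_surjective
  out_surjective := V.out_surjective.comp e.symm.surjective
  genus := V.genus

/-- Absorbs the associator in the Frobenius relations into the cobordism before it, so that a
composite of three cobordisms becomes a gluing of two. Each glued component has one piece of `V` and
one cylinder for each of its circles in `J`: its graph is a star, which adds no genus. -/
theorem comp_cylinder [Finite J] (V : Cob I J) (e : J ≃ K) :
    (V.comp (cylinder e)).Diffeo (V.relabelOut e) := by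
  let f : (V.comp (cylinder e)).Comp → V.Comp :=
    Quot.lift (Sum.elim id (V.out ∘ e.symm)) (by
      rintro _ _ ⟨j, rfl, rfl⟩
      simp [cylinder])
  have hinr : ∀ k : K, glue V (cylinder e) (Sum.inr k) =
      glue V (cylinder e) (Sum.inl (V.out (e.symm k))) := fun k =>
    (Quot.sound ⟨e.symm k, rfl, congrArg Sum.inr (e.apply_symm_apply k).symm⟩).symm
  have hinl : ∀ c c' : V.Comp, glue V (cylinder e) (Sum.inl c) =
      glue V (cylinder e) (Sum.inl c') ↔ c = c' :=
    fun c c' => ⟨fun h => congrArg f h, fun h => by rw [h]⟩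
  let E : (V.comp (cylinder e)).Comp ≃ V.Comp :=
    { toFun := f
      invFun := fun c => glue V (cylinder e) (Sum.inl c)
      left_inv := by
        rintro ⟨x | x⟩
        · rfl
        · exact (hinr x).symm
      right_inv := fun _ => rfl }
  refine ⟨E, fun _ => rfl, fun _ => rfl, fun q => ?_⟩
  obtain ⟨c, rfl⟩ := E.symm.surjective q
  change V.genus c = (∑ᶠ x : {x : V.Comp ⊕ (cylinder e).Comp // glue V (cylinder e) x =
      glue V (cylinder e) (Sum.inl c)}, Sum.elim V.genus (fun _ => 0) x.1) +
    (Nat.card {j : J // glue V (cylinder e) (Sum.inl (V.out j)) =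
      glue V (cylinder e) (Sum.inl c)} + 1 -
      Nat.card {x : V.Comp ⊕ (cylinder e).Comp // glue V (cylinder e) x = glue V (cylinder e) (Sum.inl c)})
  have hcard : Nat.card {x : V.Comp ⊕ (cylinder e).Comp // glue V (cylinder e) x =
      glue V (cylinder e) (Sum.inl c)} =
      Nat.card {j : J // glue V (cylinder e) (Sum.inl (V.out j)) =
        glue V (cylinder e) (Sum.inl c)} + 1 := by
    have : Finite (cylinder e).Comp := Finite.of_equiv J e
    let _ : Unique {a : V.Comp // glue V (cylinder e) (Sum.inl a) =
        glue V (cylinder e) (Sum.inl c)} :=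
      ⟨⟨⟨c, rfl⟩⟩, fun a => Subtype.ext ((hinl _ _).1 a.2)⟩
    have : Finite {k : (cylinder e).Comp // glue V (cylinder e) (Sum.inr k) =
        glue V (cylinder e) (Sum.inl c)} := Subtype.finite
    have h1 : Nat.card {k : (cylinder e).Comp // glue V (cylinder e) (Sum.inr k) =
        glue V (cylinder e) (Sum.inl c)} = Nat.card {j : J //
          glue V (cylinder e) (Sum.inl (V.out j)) = glue V (cylinder e) (Sum.inl c)} :=
      Nat.card_congr (e.symm.subtypeEquiv fun k => by
        rw [show glue V (cylinder e) (Sum.inr k) = _ from hinr k])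
    refine (Nat.card_congr Equiv.subtypeSum).trans (Nat.card_sum.trans ?_)
    exact (congrArg₂ (· + ·) Nat.card_unique h1).trans (add_comm _ _)
  rw [hcard, Nat.sub_self, add_zero, finsum_eq_single _ ⟨Sum.inl c, rfl⟩]
  · rfl
  · rintro ⟨x | x, hx⟩ hne
    · exact absurd (Subtype.ext (congrArg Sum.inl ((hinl _ _).1 hx))) hne
    · rfl

end Cob

/-! ### Values of the functor as maps between tensor powers. -/

namespace AlmostTQFT

variable {R : Type*} [CommRing R] {A : Type*} [AddCommGroup A] [Module R A]

open Cob

variable (R A) in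
/-- The value on `I ⊔ J` is the tensor product of those on `I` and `J`. -/
noncomputable def sumCircles {I J : Type} {M N : Type*} [AddCommGroup M] [AddCommGroup N]
    [Module R M] [Module R N] (e : (⨂[R] _ : I, A) ≃ₗ[R] M) (f : (⨂[R] _ : J, A) ≃ₗ[R] N) :
    (⨂[R] _ : I ⊕ J, A) ≃ₗ[R] M ⊗[R] N :=
  (PiTensorProduct.tmulEquiv R A).symm ≪≫ₗ TensorProduct.congr e f

theorem sumCircles_symm_tmul {I J : Type} {M N : Type*} [AddCommGroup M] [AddCommGroup N]
    [Module R M] [Module R N] (e : (⨂[R] _ : I, A) ≃ₗ[R] M) (f : (⨂[R] _ : J, A) ≃ₗ[R] N)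
    {x : M} {y : N} {a : I → A} {b : J → A} (hx : e.symm x = PiTensorProduct.tprod R a)
    (hy : f.symm y = PiTensorProduct.tprod R b) :
    (sumCircles R A e f).symm (x ⊗ₜ y) = PiTensorProduct.tprod R (Sum.elim a b) := by
  simp [sumCircles, hx, hy]

theorem oneCircle_symm_apply (a : A) :
    (oneCircle R A).symm a = PiTensorProduct.tprod R fun _ => a := by
  rw [LinearEquiv.symm_apply_eq]
  simp [oneCircle]

theorem twoCircles_eq : twoCircles R A = sumCircles R A (oneCircle R A) (oneCircle R A) := rfl

theorem twoCircles_symm_tmul (a b : A) :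
    (twoCircles R A).symm (a ⊗ₜ b) =
      PiTensorProduct.tprod R (Sum.elim (fun _ => a) fun _ => b) :=
  sumCircles_symm_tmul _ _ (oneCircle_symm_apply a) (oneCircle_symm_apply b)

variable (F : AlmostTQFT R A)

section conj

variable {I J K I' J' : Type} [Finite I] [Nonempty I] [Finite J] [Nonempty J] [Finite K]
  [Nonempty K] [Finite I'] [Nonempty I'] [Finite J'] [Nonempty J']
  {M N P M' N' : Type*} [AddCommGroup M] [AddCommGroup N] [AddCommGroup P] [AddCommGroup M']
  [AddCommGroup N'] [Module R M] [Module R N] [Module R P] [Module R M'] [Module R N']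

/-- The value of `F` on a cobordism, read through identifications of its source and target. -/
noncomputable def conj (e : (⨂[R] _ : I, A) ≃ₗ[R] M) (f : (⨂[R] _ : J, A) ≃ₗ[R] N)
    (V : Cob I J) : M →ₗ[R] N :=
  f.toLinearMap ∘ₗ F.map V ∘ₗ e.symm.toLinearMap

theorem conj_comp (e : (⨂[R] _ : I, A) ≃ₗ[R] M) (f : (⨂[R] _ : J, A) ≃ₗ[R] N)
    (g : (⨂[R] _ : K, A) ≃ₗ[R] P) (V : Cob I J) (W : Cob J K) :
    F.conj e g (V.comp W) = F.conj f g W ∘ₗ F.conj e f V := by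
  ext x
  simp [conj, F.map_comp]

theorem conj_congr (e : (⨂[R] _ : I, A) ≃ₗ[R] M) (f : (⨂[R] _ : J, A) ≃ₗ[R] N) {V W : Cob I J}
    (h : V.Diffeo W) : F.conj e f V = F.conj e f W := by
  rw [conj, conj, F.map_congr V W h]

theorem conj_cylinder_refl (e : (⨂[R] _ : I, A) ≃ₗ[R] M) :
    F.conj e e (cylinder (Equiv.refl I)) = LinearMap.id := by
  ext x
  simp [conj, F.map_cylinder]

theorem conj_disjUnion (e : (⨂[R] _ : I, A) ≃ₗ[R] M) (f : (⨂[R] _ : J, A) ≃ₗ[R] N)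
    (e' : (⨂[R] _ : I', A) ≃ₗ[R] M') (f' : (⨂[R] _ : J', A) ≃ₗ[R] N') (V : Cob I J)
    (W : Cob I' J') :
    F.conj (sumCircles R A e e') (sumCircles R A f f') (V.disjUnion W) =
      TensorProduct.map (F.conj e f V) (F.conj e' f' W) := by
  ext x y
  simp [conj, F.map_disjUnion, sumCircles]

end conj

theorem mul_eq_conj : F.mul = F.conj (twoCircles R A) (oneCircle R A) (sphere _ _) := rfl

theorem comul_eq_conj : F.comul = F.conj (oneCircle R A) (twoCircles R A) (sphere _ _) := rfl

theorem conj_cylinder_sumComm :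
    F.conj (twoCircles R A) (twoCircles R A) (cylinder (Equiv.sumComm Unit Unit)) =
      (TensorProduct.comm R A A).toLinearMap := by
  ext x y
  simp only [conj, F.map_cylinder, TensorProduct.AlgebraTensorModule.curry_apply,
    LinearMap.restrictScalars_self, TensorProduct.curry_apply, LinearMap.coe_comp,
    LinearEquiv.coe_coe, Function.comp_apply, TensorProduct.comm_tmul]
  rw [← LinearEquiv.eq_symm_apply, twoCircles_symm_tmul, twoCircles_symm_tmul]
  simp only [PiTensorProduct.reindex_tprod]
  congr 1
  ext (i | i) <;> rfl

theorem conj_cylinder_sumAssoc :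
    F.conj (sumCircles R A (twoCircles R A) (oneCircle R A))
      (sumCircles R A (oneCircle R A) (twoCircles R A))
      (cylinder (Equiv.sumAssoc Unit Unit Unit)) =
      (TensorProduct.assoc R A A A).toLinearMap := by
  ext x y z
  simp only [conj, F.map_cylinder, TensorProduct.AlgebraTensorModule.curry_apply,
    LinearMap.restrictScalars_self, TensorProduct.curry_apply, LinearMap.coe_comp,
    LinearEquiv.coe_coe, Function.comp_apply, TensorProduct.assoc_tmul]
  rw [← LinearEquiv.eq_symm_apply,
    sumCircles_symm_tmul _ _ (twoCircles_symm_tmul x y) (oneCircle_symm_apply z),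
    sumCircles_symm_tmul _ _ (oneCircle_symm_apply x) (twoCircles_symm_tmul y z)]
  simp only [PiTensorProduct.reindex_tprod]
  congr 1
  ext (i | i | i) <;> rfl

theorem conj_cylinder_sumAssoc_symm :
    F.conj (sumCircles R A (oneCircle R A) (twoCircles R A))
      (sumCircles R A (twoCircles R A) (oneCircle R A))
      (cylinder (Equiv.sumAssoc Unit Unit Unit).symm) =
      (TensorProduct.assoc R A A A).symm.toLinearMap := by
  ext x y z
  simp only [conj, F.map_cylinder, TensorProduct.AlgebraTensorModule.curry_apply,
    LinearMap.restrictScalars_self, TensorProduct.curry_apply, LinearMap.coe_comp,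
    LinearEquiv.coe_coe, Function.comp_apply, TensorProduct.assoc_symm_tmul]
  rw [← LinearEquiv.eq_symm_apply,
    sumCircles_symm_tmul _ _ (twoCircles_symm_tmul x y) (oneCircle_symm_apply z),
    sumCircles_symm_tmul _ _ (oneCircle_symm_apply x) (twoCircles_symm_tmul y z)]
  simp only [PiTensorProduct.reindex_tprod]
  congr 1
  ext ((i | i) | i) <;> rfl

theorem rTensor_mul_eq_conj : F.mul.rTensor A =
    F.conj (sumCircles R A (twoCircles R A) (oneCircle R A)) (twoCircles R A)
      ((sphere (Unit ⊕ Unit) Unit).disjUnion (cylinder (Equiv.refl Unit))) := by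
  rw [twoCircles_eq, conj_disjUnion, conj_cylinder_refl]; rfl

theorem lTensor_mul_eq_conj : F.mul.lTensor A =
    F.conj (sumCircles R A (oneCircle R A) (twoCircles R A)) (twoCircles R A)
      ((cylinder (Equiv.refl Unit)).disjUnion (sphere (Unit ⊕ Unit) Unit)) := by
  rw [twoCircles_eq, conj_disjUnion, conj_cylinder_refl]; rfl

theorem rTensor_comul_eq_conj : F.comul.rTensor A =
    F.conj (twoCircles R A) (sumCircles R A (twoCircles R A) (oneCircle R A))
      ((sphere Unit (Unit ⊕ Unit)).disjUnion (cylinder (Equiv.refl Unit))) := by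
  rw [twoCircles_eq, conj_disjUnion, conj_cylinder_refl]; rfl

theorem lTensor_comul_eq_conj : F.comul.lTensor A =
    F.conj (twoCircles R A) (sumCircles R A (oneCircle R A) (twoCircles R A))
      ((cylinder (Equiv.refl Unit)).disjUnion (sphere Unit (Unit ⊕ Unit))) := by
  rw [twoCircles_eq, conj_disjUnion, conj_cylinder_refl]; rfl

end AlmostTQFT

/-! ### The gluings that occur in the nearly Frobenius relations. -/

namespace Cob

/-- A pair of pants with two incoming and one outgoing circle, beside a cylinder. -/
abbrev mergeCylinder : Cob ((Unit ⊕ Unit) ⊕ Unit) (Unit ⊕ Unit) :=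
  (sphere (Unit ⊕ Unit) Unit).disjUnion (cylinder (Equiv.refl Unit))

/-- A cylinder beside a pair of pants with two incoming and one outgoing circle. -/
abbrev cylinderMerge : Cob (Unit ⊕ (Unit ⊕ Unit)) (Unit ⊕ Unit) :=
  (cylinder (Equiv.refl Unit)).disjUnion (sphere (Unit ⊕ Unit) Unit)

/-- A pair of pants with one incoming and two outgoing circles, beside a cylinder. -/
abbrev splitCylinder : Cob (Unit ⊕ Unit) ((Unit ⊕ Unit) ⊕ Unit) :=
  (sphere Unit (Unit ⊕ Unit)).disjUnion (cylinder (Equiv.refl Unit))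

/-- A cylinder beside a pair of pants with one incoming and two outgoing circles. -/
abbrev cylinderSplit : Cob (Unit ⊕ Unit) (Unit ⊕ (Unit ⊕ Unit)) :=
  (cylinder (Equiv.refl Unit)).disjUnion (sphere Unit (Unit ⊕ Unit))

instance {I J : Type} [Nonempty I] [Nonempty J] : Unique (sphere I J).Comp :=
  inferInstanceAs (Unique Unit)

instance : Unique (cylinder (Equiv.refl Unit)).Comp := inferInstanceAs (Unique Unit)

instance {I J I' J' : Type} (V : Cob I J) (W : Cob I' J') [Finite V.Comp] [Finite W.Comp] :
    Finite (V.disjUnion W).Comp := inferInstanceAs (Finite (V.Comp ⊕ W.Comp))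

theorem card_comp_disjUnion {I J I' J' : Type} (V : Cob I J) (W : Cob I' J') [Unique V.Comp]
    [Unique W.Comp] : Nat.card (V.disjUnion W).Comp = 2 := by
  change Nat.card (V.Comp ⊕ W.Comp) = 2
  rw [Nat.card_sum, Nat.card_unique, Nat.card_unique]

theorem genus_disjUnion {I J I' J' : Type} {V : Cob I J} {W : Cob I' J'}
    (hV : ∀ c, V.genus c = 0) (hW : ∀ c, W.genus c = 0) : ∀ c, (V.disjUnion W).genus c = 0
  | .inl c => hV c
  | .inr c => hW c

theorem disjUnion_comp_sphere {I J I' J' K : Type} [Nonempty I] [Nonempty K] (V : Cob I J)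
    (W : Cob I' J') [Unique V.Comp] [Unique W.Comp] [Unique J] [Unique J']
    (hV : ∀ c, V.genus c = 0) (hW : ∀ c, W.genus c = 0) :
    ((V.disjUnion W).comp (sphere (J ⊕ J') K)).Diffeo (sphere (I ⊕ I') K) := by
  have := subsingleton_comp_right (V.disjUnion W) (sphere (J ⊕ J') K)
  refine comp_diffeo_sphere _ _ (genus_disjUnion hV hW) (fun _ => rfl) ?_
  rw [Nat.card_sum, Nat.card_unique (α := J), Nat.card_unique (α := J'), card_comp_disjUnion,
    Nat.card_unique]

theorem sphere_comp_disjUnion {I J I' J' K : Type} [Nonempty K] [Nonempty J] (V : Cob I J)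
    (W : Cob I' J') [Unique V.Comp] [Unique W.Comp] [Unique I] [Unique I']
    (hV : ∀ c, V.genus c = 0) (hW : ∀ c, W.genus c = 0) :
    ((sphere K (I ⊕ I')).comp (V.disjUnion W)).Diffeo (sphere K (J ⊕ J')) := by
  have := subsingleton_comp_left (sphere K (I ⊕ I')) (V.disjUnion W)
  refine comp_diffeo_sphere _ _ (fun _ => rfl) (genus_disjUnion hV hW) ?_
  rw [Nat.card_sum, Nat.card_unique (α := I), Nat.card_unique (α := I'), card_comp_disjUnion,
    Nat.card_unique]

/-- The four pieces form a path with three circles as edges: cylinder, split pants, merge pants,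
cylinder. -/
theorem splitCylinder_comp_cylinderMerge :
    ((splitCylinder.relabelOut (Equiv.sumAssoc Unit Unit Unit)).comp cylinderMerge).Diffeo
      (sphere (Unit ⊕ Unit) (Unit ⊕ Unit)) := by
  set V := splitCylinder.relabelOut (Equiv.sumAssoc Unit Unit Unit)
  have : Finite V.Comp := inferInstanceAs (Finite splitCylinder.Comp)
  have h1 : glue V cylinderMerge (Sum.inl (Sum.inl ())) =
      glue V cylinderMerge (Sum.inr (Sum.inl ())) := Quot.sound ⟨Sum.inl (), rfl, rfl⟩
  have h2 : glue V cylinderMerge (Sum.inl (Sum.inl ())) =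
      glue V cylinderMerge (Sum.inr (Sum.inr ())) := Quot.sound ⟨Sum.inr (Sum.inl ()), rfl, rfl⟩
  have h3 : glue V cylinderMerge (Sum.inl (Sum.inr ())) =
      glue V cylinderMerge (Sum.inr (Sum.inr ())) := Quot.sound ⟨Sum.inr (Sum.inr ()), rfl, rfl⟩
  have key : ∀ q : (V.comp cylinderMerge).Comp,
      q = glue V cylinderMerge (Sum.inl (Sum.inl ())) := by
    rintro ⟨(_ | _) | (_ | _)⟩
    exacts [rfl, h3.trans h2.symm, h1.symm, h2.symm]
  have : Subsingleton (V.comp cylinderMerge).Comp := ⟨fun a b => (key a).trans (key b).symm⟩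
  refine comp_diffeo_sphere _ _ (genus_disjUnion (fun _ => rfl) fun _ => rfl)
    (genus_disjUnion (fun _ => rfl) fun _ => rfl) ?_
  change _ ≤ Nat.card splitCylinder.Comp + _
  rw [card_comp_disjUnion, card_comp_disjUnion]
  simp

theorem cylinderSplit_comp_mergeCylinder :
    ((cylinderSplit.relabelOut (Equiv.sumAssoc Unit Unit Unit).symm).comp mergeCylinder).Diffeo
      (sphere (Unit ⊕ Unit) (Unit ⊕ Unit)) := by
  set V := cylinderSplit.relabelOut (Equiv.sumAssoc Unit Unit Unit).symm
  have : Finite V.Comp := inferInstanceAs (Finite cylinderSplit.Comp)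
  have h1 : glue V mergeCylinder (Sum.inl (Sum.inl ())) =
      glue V mergeCylinder (Sum.inr (Sum.inl ())) := Quot.sound ⟨Sum.inl (Sum.inl ()), rfl, rfl⟩
  have h2 : glue V mergeCylinder (Sum.inl (Sum.inr ())) =
      glue V mergeCylinder (Sum.inr (Sum.inl ())) := Quot.sound ⟨Sum.inl (Sum.inr ()), rfl, rfl⟩
  have h3 : glue V mergeCylinder (Sum.inl (Sum.inr ())) =
      glue V mergeCylinder (Sum.inr (Sum.inr ())) := Quot.sound ⟨Sum.inr (), rfl, rfl⟩
  have key : ∀ q : (V.comp mergeCylinder).Comp,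
      q = glue V mergeCylinder (Sum.inl (Sum.inl ())) := by
    rintro ⟨(_ | _) | (_ | _)⟩
    exacts [rfl, h2.trans h1.symm, h1.symm, h3.symm.trans (h2.trans h1.symm)]
  have : Subsingleton (V.comp mergeCylinder).Comp := ⟨fun a b => (key a).trans (key b).symm⟩
  refine comp_diffeo_sphere _ _ (genus_disjUnion (fun _ => rfl) fun _ => rfl)
    (genus_disjUnion (fun _ => rfl) fun _ => rfl) ?_
  change _ ≤ Nat.card cylinderSplit.Comp + _
  rw [card_comp_disjUnion, card_comp_disjUnion]
  simp

end Cob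

/-! ### The nearly Frobenius relations. -/

namespace AlmostTQFT

variable {R : Type*} [CommRing R] {A : Type*} [AddCommGroup A] [Module R A] (F : AlmostTQFT R A)

open Cob

theorem mul_comp_comm : F.mul ∘ₗ (TensorProduct.comm R A A).toLinearMap = F.mul := by
  rw [← conj_cylinder_sumComm F, mul_eq_conj, ← conj_comp]
  exact F.conj_congr _ _ (cylinder_comp_sphere _)

theorem comm_comp_comul : (TensorProduct.comm R A A).toLinearMap ∘ₗ F.comul = F.comul := by
  rw [← conj_cylinder_sumComm F, comul_eq_conj, ← conj_comp]
  exact F.conj_congr _ _ (sphere_comp_cylinder _)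

theorem mul_comp_rTensor_mul : F.mul ∘ₗ F.mul.rTensor A =
    F.mul ∘ₗ F.mul.lTensor A ∘ₗ (TensorProduct.assoc R A A A).toLinearMap := by
  have h1 : F.mul ∘ₗ F.mul.rTensor A =
      F.conj (sumCircles R A (twoCircles R A) (oneCircle R A)) (oneCircle R A) (sphere _ _) := by
    rw [rTensor_mul_eq_conj, mul_eq_conj, ← conj_comp]
    exact F.conj_congr _ _ (disjUnion_comp_sphere _ _ (fun _ => rfl) fun _ => rfl)
  have h2 : F.mul ∘ₗ F.mul.lTensor A =
      F.conj (sumCircles R A (oneCircle R A) (twoCircles R A)) (oneCircle R A) (sphere _ _) := by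
    rw [lTensor_mul_eq_conj, mul_eq_conj, ← conj_comp]
    exact F.conj_congr _ _ (disjUnion_comp_sphere _ _ (fun _ => rfl) fun _ => rfl)
  rw [h1, ← LinearMap.comp_assoc, h2, ← conj_cylinder_sumAssoc F, ← conj_comp]
  exact F.conj_congr _ _ (cylinder_comp_sphere _).symm

theorem rTensor_comul_comp_comul :
    (TensorProduct.assoc R A A A).toLinearMap ∘ₗ F.comul.rTensor A ∘ₗ F.comul =
      F.comul.lTensor A ∘ₗ F.comul := by
  have h1 : F.comul.rTensor A ∘ₗ F.comul =
      F.conj (oneCircle R A) (sumCircles R A (twoCircles R A) (oneCircle R A)) (sphere _ _) := by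
    rw [rTensor_comul_eq_conj, comul_eq_conj, ← conj_comp]
    exact F.conj_congr _ _ (sphere_comp_disjUnion _ _ (fun _ => rfl) fun _ => rfl)
  have h2 : F.comul.lTensor A ∘ₗ F.comul =
      F.conj (oneCircle R A) (sumCircles R A (oneCircle R A) (twoCircles R A)) (sphere _ _) := by
    rw [lTensor_comul_eq_conj, comul_eq_conj, ← conj_comp]
    exact F.conj_congr _ _ (sphere_comp_disjUnion _ _ (fun _ => rfl) fun _ => rfl)
  rw [h1, h2, ← conj_cylinder_sumAssoc F, ← conj_comp]
  exact F.conj_congr _ _ (sphere_comp_cylinder _)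

/-- The common value of all sides of the Frobenius relations: the connected genus `0` cobordism from
two circles to two circles. -/
theorem comul_comp_mul :
    F.comul ∘ₗ F.mul = F.conj (twoCircles R A) (twoCircles R A) (sphere _ _) := by
  rw [comul_eq_conj, mul_eq_conj, ← conj_comp]
  have := subsingleton_comp_right (sphere (Unit ⊕ Unit) Unit) (sphere Unit (Unit ⊕ Unit))
  exact F.conj_congr _ _ (comp_diffeo_sphere _ _ (fun _ => rfl) (fun _ => rfl) (by simp))

theorem lTensor_mul_comp_rTensor_comul :
    F.mul.lTensor A ∘ₗ (TensorProduct.assoc R A A A).toLinearMap ∘ₗ F.comul.rTensor A =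
      F.comul ∘ₗ F.mul := by
  rw [comul_comp_mul, lTensor_mul_eq_conj, ← conj_cylinder_sumAssoc F, rTensor_comul_eq_conj,
    ← conj_comp, F.conj_congr _ _ (comp_cylinder _ _), ← conj_comp]
  exact F.conj_congr _ _ splitCylinder_comp_cylinderMerge

theorem rTensor_mul_comp_lTensor_comul :
    F.mul.rTensor A ∘ₗ (TensorProduct.assoc R A A A).symm.toLinearMap ∘ₗ F.comul.lTensor A =
      F.comul ∘ₗ F.mul := by
  rw [comul_comp_mul, rTensor_mul_eq_conj, ← conj_cylinder_sumAssoc_symm F,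
    lTensor_comul_eq_conj, ← conj_comp, F.conj_congr _ _ (comp_cylinder _ _), ← conj_comp]
  exact F.conj_congr _ _ cylinderSplit_comp_mergeCylinder

theorem isNearlyFrobenius : IsNearlyFrobenius R F.mul F.comul where
  mul_assoc x y z := by simpa using LinearMap.congr_fun F.mul_comp_rTensor_mul (x ⊗ₜ y ⊗ₜ z)
  mul_comm x y := by simpa using LinearMap.congr_fun F.mul_comp_comm (y ⊗ₜ x)
  coassoc x := LinearMap.congr_fun F.rTensor_comul_comp_comul x
  cocomm x := LinearMap.congr_fun F.comm_comp_comul x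
  frobenius_left x y :=
    (LinearMap.congr_fun F.lTensor_mul_comp_rTensor_comul (x ⊗ₜ y)).symm
  frobenius_right x y :=
    (LinearMap.congr_fun F.rTensor_mul_comp_lTensor_comul (x ⊗ₜ y)).symm

end AlmostTQFT

/-! ### Splitting three-term complexes with homology in one degree. -/

section ShortComplex

variable {R : Type*} [CommRing R] {M N P : Type*} [AddCommGroup M] [AddCommGroup N]
  [AddCommGroup P] [Module R M] [Module R N] [Module R P]

theorem Function.Exact.exists_prodEquiv_of_projective {f : M →ₗ[R] N} {g : N →ₗ[R] P}
    (h : Function.Exact f g) (hf : Function.Injective f) (hg : Function.Surjective g)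
    [Module.Projective R P] :
    ∃ e : N ≃ₗ[R] M × P, f = e.symm ∘ₗ LinearMap.inl R M P ∧ g = LinearMap.snd R M P ∘ₗ e :=
  let ⟨l, hl⟩ := Module.projective_lifting_property g LinearMap.id hg
  ⟨_, (h.splitSurjectiveEquiv hf ⟨l, hl⟩).2⟩

theorem Submodule.exists_prodEquiv_quotient (S : Submodule R N) [Module.Projective R (N ⧸ S)] :
    ∃ e : N ≃ₗ[R] S × (N ⧸ S), S.subtype = e.symm ∘ₗ LinearMap.inl R S (N ⧸ S) :=
  have ⟨e, he, _⟩ := (LinearMap.exact_subtype_mkQ S).exists_prodEquiv_of_projective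
    S.injective_subtype S.mkQ_surjective
  ⟨e, he⟩

theorem LinearMap.exists_prodEquiv_ker {f : M →ₗ[R] N} (hf : Function.Surjective f)
    [Module.Projective R N] :
    ∃ e : M ≃ₗ[R] LinearMap.ker f × N, (LinearMap.ker f).subtype = e.symm ∘ₗ LinearMap.inl R (LinearMap.ker f) N :=
  have ⟨e, he, _⟩ := (LinearMap.exact_subtype_ker_map f).exists_prodEquiv_of_projective
    (LinearMap.ker f).injective_subtype hf
  ⟨e, he⟩

theorem exists_retraction_of_prodEquiv {f : M →ₗ[R] N} {e : N ≃ₗ[R] M × P}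
    (he : f = e.symm ∘ₗ LinearMap.inl R M P) : ∃ r : N →ₗ[R] M, ∀ x, r (f x) = x :=
  ⟨LinearMap.fst R M P ∘ₗ e.toLinearMap, fun x => by simp [he]⟩

variable {B : Type*} [AddCommGroup B] [Module R B] {f : M →ₗ[R] N} {g : N →ₗ[R] P}

/-- A complex of projective modules whose homology is projective and sits in the middle splits. -/
theorem split_of_homology_middle [Module.Projective R P] [Module.Projective R B]
    (hgf : g ∘ₗ f = 0) (hf : Function.Injective f) (hg : Function.Surjective g)
    (e : (LinearMap.ker g ⧸ (LinearMap.range f).submoduleOf (LinearMap.ker g)) ≃ₗ[R] B) :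
    (∃ r : N →ₗ[R] M, ∀ x, r (f x) = x) ∧ Nonempty (N ≃ₗ[R] (M × B) × P) := by
  have : Module.Projective R
      (LinearMap.ker g ⧸ (LinearMap.range f).submoduleOf (LinearMap.ker g)) :=
    Module.Projective.of_equiv e.symm
  -- Projectivity of `P` splits the cycles off `N`, projectivity of the homology splits the
  -- boundaries off the cycles, and the boundaries are a copy of `M` because `f` is injective.
  obtain ⟨e1, h1⟩ := LinearMap.exists_prodEquiv_ker hg
  obtain ⟨e2, h2⟩ := ((LinearMap.range f).submoduleOf (LinearMap.ker g)).exists_prodEquiv_quotient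
  have hle : LinearMap.range f ≤ LinearMap.ker g := LinearMap.range_le_ker_iff.2 hgf
  let e3 : ((LinearMap.range f).submoduleOf (LinearMap.ker g)) ≃ₗ[R] M :=
    Submodule.submoduleOfEquivOfLe hle ≪≫ₗ (LinearEquiv.ofInjective f hf).symm
  obtain ⟨r1, h1⟩ := exists_retraction_of_prodEquiv h1
  obtain ⟨r2, h2⟩ := exists_retraction_of_prodEquiv h2
  refine ⟨⟨e3.toLinearMap ∘ₗ r2 ∘ₗ r1, fun x => ?_⟩,
    ⟨e1 ≪≫ₗ (e2 ≪≫ₗ e3.prodCongr e).prodCongr (LinearEquiv.refl R P)⟩⟩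
  have hx : f x ∈ LinearMap.ker g := hle ⟨x, rfl⟩
  have h3 : r1 (f x) = ⟨f x, hx⟩ := h1 ⟨f x, hx⟩
  have h4 : r2 ⟨f x, hx⟩ = ⟨⟨f x, hx⟩, ⟨x, rfl⟩⟩ := h2 ⟨⟨f x, hx⟩, ⟨x, rfl⟩⟩
  simp only [LinearMap.comp_apply, h3, h4, LinearEquiv.coe_coe, e3, LinearEquiv.trans_apply]
  rw [LinearEquiv.symm_apply_eq]
  rfl

/-- The cycles `ker g` are a direct summand of `N`, hence projective, so `f`, which maps onto them,
splits as well. -/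
theorem split_of_homology_left [Module.Projective R N] [Module.Projective R P] (hgf : g ∘ₗ f = 0)
    (hexact : LinearMap.ker g ≤ LinearMap.range f) (hg : Function.Surjective g)
    (e : LinearMap.ker f ≃ₗ[R] B) : Nonempty ((M × P) ≃ₗ[R] B × N) := by
  obtain ⟨e1, h1⟩ := LinearMap.exists_prodEquiv_ker hg
  obtain ⟨r1, h1⟩ := exists_retraction_of_prodEquiv h1
  have : Module.Projective R (LinearMap.ker g) :=
    Module.Projective.of_split (LinearMap.ker g).subtype r1 (LinearMap.ext h1)
  have hgf' : ∀ x, f x ∈ LinearMap.ker g := fun x => LinearMap.congr_fun hgf x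
  obtain ⟨e2, -⟩ := LinearMap.exists_prodEquiv_ker (f := f.codRestrict (LinearMap.ker g) hgf')
    fun ⟨y, hy⟩ => by
      obtain ⟨x, rfl⟩ := hexact hy
      exact ⟨x, rfl⟩
  let e3 : LinearMap.ker (f.codRestrict (LinearMap.ker g) hgf') ≃ₗ[R] B :=
    LinearEquiv.ofEq _ _ (LinearMap.ker_codRestrict _ _ _) ≪≫ₗ e
  exact ⟨(e2 ≪≫ₗ e3.prodCongr (.refl R _)).prodCongr (.refl R P) ≪≫ₗ
    LinearEquiv.prodAssoc R B (LinearMap.ker g) P ≪≫ₗ (LinearEquiv.refl R B).prodCongr e1.symm⟩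

/-- Projectivity of the cokernel makes `range g` a direct summand of `P`, hence projective, so that
`N` splits as `ker g ≅ M` plus `range g`. -/
theorem split_of_homology_right [Module.Projective R P] [Module.Projective R B] (hgf : g ∘ₗ f = 0)
    (hf : Function.Injective f) (hexact : LinearMap.ker g ≤ LinearMap.range f)
    (e : (P ⧸ LinearMap.range g) ≃ₗ[R] B) : Nonempty ((N × B) ≃ₗ[R] M × P) := by
  have : Module.Projective R (P ⧸ LinearMap.range g) := Module.Projective.of_equiv e.symm
  obtain ⟨e1, h1⟩ := (LinearMap.range g).exists_prodEquiv_quotient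
  obtain ⟨r1, h1⟩ := exists_retraction_of_prodEquiv h1
  have : Module.Projective R (LinearMap.range g) :=
    Module.Projective.of_split (LinearMap.range g).subtype r1 (LinearMap.ext h1)
  obtain ⟨e2, -⟩ := LinearMap.exists_prodEquiv_ker g.surjective_rangeRestrict
  let e3 : LinearMap.ker g.rangeRestrict ≃ₗ[R] M :=
    LinearEquiv.ofEq _ _ (g.ker_rangeRestrict.trans
      (le_antisymm hexact (LinearMap.range_le_ker_iff.2 hgf))) ≪≫ₗ
      (LinearEquiv.ofInjective f hf).symm
  exact ⟨(e2 ≪≫ₗ e3.prodCongr (.refl R _)).prodCongr e.symm ≪≫ₗ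
    LinearEquiv.prodAssoc R M (LinearMap.range g) _ ≪≫ₗ (LinearEquiv.refl R M).prodCongr e1.symm⟩

end ShortComplex

/-! ### Decidability of arcs. -/

namespace Slice

/-- The strand number, quantified over all naturals in the definition, can be read off from an
endpoint; this makes the circles of concrete diagrams computable by `decide`. -/
instance decidableVerticalArc (k : ℕ) (p q : ℕ × ℕ) : Decidable (VerticalArc k p q) :=
  decidable_of_iff (p.1 = k ∧ q = (k + 1, p.2)) <| by
    obtain ⟨a, b⟩ := p
    simp only [VerticalArc, Prod.mk.injEq]
    exact ⟨fun ⟨h1, h2⟩ => ⟨b, ⟨h1, rfl⟩, h2⟩, fun ⟨_, ⟨h1, h3⟩, h2⟩ => ⟨h1, h3 ▸ h2⟩⟩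

instance decidableHorizontalArc (k i : ℕ) (p q : ℕ × ℕ) : Decidable (HorizontalArc k i p q) :=
  decidable_of_iff ((p = (k, i) ∧ q = (k, i + 1)) ∨ (p = (k + 1, i) ∧ q = (k + 1, i + 1)) ∨
    (p.2 ≠ i ∧ p.2 ≠ i + 1 ∧ p.1 = k ∧ q = (k + 1, p.2))) <| by
    obtain ⟨a, b⟩ := p
    refine or_congr Iff.rfl (or_congr Iff.rfl ?_)
    simp only [Prod.mk.injEq]
    exact ⟨fun ⟨h1, h2, h3, h4⟩ => ⟨b, h1, h2, ⟨h3, rfl⟩, h4⟩,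
      fun ⟨_, h1, h2, ⟨h3, h5⟩, h4⟩ => by subst h5; exact ⟨h1, h2, h3, h4⟩⟩

instance decidableArc (b : Bool) (k : ℕ) : ∀ (s : Slice) (p q : ℕ × ℕ), Decidable (s.Arc b k p q)
  | cup i, p, q => decidable_of_iff ((p = (k + 1, i) ∧ q = (k + 1, i + 1)) ∨
      (p.1 = k ∧ q = (k + 1, if p.2 < i then p.2 else p.2 + 2))) <| by
    obtain ⟨a, b⟩ := p
    refine or_congr Iff.rfl ?_
    simp only [Prod.mk.injEq]
    exact ⟨fun ⟨h1, h2⟩ => ⟨b, ⟨h1, rfl⟩, h2⟩, fun ⟨_, ⟨h1, h3⟩, h2⟩ => by subst h3; exact ⟨h1, h2⟩⟩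
  | cap i, p, q => decidable_of_iff ((p = (k, i) ∧ q = (k, i + 1)) ∨
      (q.1 = k + 1 ∧ p = (k, if q.2 < i then q.2 else q.2 + 2))) <| by
    obtain ⟨a, b⟩ := q
    refine or_congr Iff.rfl ?_
    simp only [Prod.mk.injEq]
    exact ⟨fun ⟨h1, h2⟩ => ⟨b, h2, ⟨h1, rfl⟩⟩, fun ⟨_, h2, ⟨h1, h3⟩⟩ => by subst h3; exact ⟨h1, h2⟩⟩
  | slash i, p, q => inferInstanceAs (Decidable (if b then HorizontalArc k i p q
      else VerticalArc k p q))
  | backslash i, p, q => inferInstanceAs (Decidable (if b then VerticalArc k p q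
      else HorizontalArc k i p q))

end Slice

/-! ### The circles in the resolutions of the two diagrams. -/

namespace LinkDiagram

instance decidableArc (D : LinkDiagram) (s : D.State) (p q : D.Point) : Decidable (D.Arc s p q) :=
  inferInstanceAs (Decidable (∃ _, _))

section Circles

variable {D : LinkDiagram} {s : D.State}

variable (D) in
/-- The points with coordinates in `l` lie on a common circle, consecutive ones being the ends of an
arc. -/
def IsPath (s : D.State) (l : List D.Point) : Prop :=
  l.IsChain fun p q => D.Arc s p q ∨ D.Arc s q p

instance (l : List D.Point) : Decidable (D.IsPath s l) :=
  inferInstanceAs (Decidable (List.IsChain _ _))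

theorem mk_eq_mk_of_arc {p q : D.Point} (h : D.Arc s p q ∨ D.Arc s q p) :
    (Quotient.mk _ p : D.Circles s) = Quotient.mk _ q := by
  rcases h with h | h
  · exact Quotient.sound (Relation.EqvGen.rel _ _ h)
  · exact (Quotient.sound (Relation.EqvGen.rel _ _ h)).symm

theorem IsPath.mk_eq_mk {l : List D.Point} (h : D.IsPath s l) {p q : D.Point} (hp : p ∈ l)
    (hq : q ∈ l) : (Quotient.mk _ p : D.Circles s) = Quotient.mk _ q := by
  have key : ∀ (l : List D.Point) (a : D.Point), D.IsPath s (a :: l) → ∀ p ∈ a :: l,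
      (Quotient.mk _ p : D.Circles s) = Quotient.mk _ a := by
    intro l
    induction l with
    | nil =>
      intro a _ p hp
      rw [List.mem_singleton.1 hp]
    | cons b l ih =>
      intro a hl p hp
      obtain ⟨hab, hl⟩ := List.isChain_cons_cons.1 hl
      rcases List.mem_cons.1 hp with rfl | hp
      · rfl
      · exact (ih b hl p hp).trans (mk_eq_mk_of_arc hab).symm
  cases l with
  | nil => exact absurd hp List.not_mem_nil
  | cons a l => exact (key l a h p hp).trans (key l a h q hq).symm

theorem subsingleton_circles (l : List D.Point) (h : D.IsPath s l) (hl : ∀ p, p ∈ l) :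
    Subsingleton (D.Circles s) :=
  ⟨by rintro ⟨p⟩ ⟨q⟩; exact h.mk_eq_mk (hl p) (hl q)⟩

/-- Each path lies on one circle, and the two circles differ because no arc leaves `l`. -/
theorem nonempty_circles_equiv (l l' : List D.Point) (h : D.IsPath s l) (h' : D.IsPath s l')
    (hmem : ∀ p, p ∈ l ↔ p ∉ l') (hne : l ≠ []) (hne' : l' ≠ [])
    (harc : ∀ p q, D.Arc s p q → (p ∈ l ↔ q ∈ l)) : Nonempty (D.Circles s ≃ Unit ⊕ Unit) := by
  classical
  obtain ⟨a, ha⟩ := List.exists_mem_of_ne_nil l hne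
  obtain ⟨b, hb⟩ := List.exists_mem_of_ne_nil l' hne'
  have hb' : b ∉ l := fun h => (hmem b).1 h hb
  let f : D.Circles s → Unit ⊕ Unit :=
    Quotient.lift (fun p => if p ∈ l then Sum.inl () else Sum.inr ()) fun p q hpq => by
      have : p ∈ l ↔ q ∈ l := by
        induction hpq with
        | rel p q h => exact harc p q h
        | refl => exact Iff.rfl
        | symm _ _ _ ih => exact ih.symm
        | trans _ _ _ _ _ ih1 ih2 => exact ih1.trans ih2
      simp only [this]
  refine ⟨⟨f, Sum.elim (fun _ => Quotient.mk _ a) fun _ => Quotient.mk _ b, ?_, ?_⟩⟩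
  · rintro ⟨p⟩
    by_cases hp : p ∈ l
    · have : f (Quot.mk _ p) = Sum.inl () := if_pos hp
      rw [this]
      exact h.mk_eq_mk ha hp
    · have : f (Quot.mk _ p) = Sum.inr () := if_neg hp
      rw [this]
      exact h'.mk_eq_mk hb (not_not.1 fun hp' => hp ((hmem p).2 hp'))
  · rintro (_ | _)
    · exact if_pos ha
    · exact if_neg hb'

end Circles

/-- The diagram of two circles side by side. -/
def twoUnknots : LinkDiagram where
  word := [.cup 0, .cup 2, .cap 2, .cap 0]
  fits := by
    intro k
    fin_cases k <;> simp [strands, Slice.Fits, Slice.width]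
  closed := rfl
  ne_nil := by simp

/-- The diagram of two circles side by side after a second Reidemeister move that slides one over
the other. -/
def overlappingUnknots : LinkDiagram where
  word := [.cup 0, .cup 2, .slash 1, .backslash 1, .cap 2, .cap 0]
  fits := by
    intro k
    fin_cases k <;> simp [strands, Slice.Fits, Slice.width]
  closed := rfl
  ne_nil := by simp

theorem reidemeisterII_twoUnknots : twoUnknots.ReidemeisterII overlappingUnknots :=
  ⟨[.cup 0, .cup 2], [.cap 2, .cap 0], 1, rfl, Or.inl rfl⟩

/-- The points of `D` with the given coordinates. -/
def points (D : LinkDiagram) (l : List (ℕ × ℕ)) : List D.Point :=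
  l.filterMap fun p => if h : p.1 < D.word.length + 1 then
    if h' : p.2 < strands D.word p.1 then some ⟨⟨p.1, h⟩, ⟨p.2, h'⟩⟩ else none else none

instance : IsEmpty twoUnknots.Crossing := ⟨by decide⟩

theorem nonempty_circles_twoUnknots_equiv (s : twoUnknots.State) :
    Nonempty (twoUnknots.Circles s ≃ Unit ⊕ Unit) := by
  obtain rfl : s = fun _ => false := Subsingleton.elim _ _
  apply nonempty_circles_equiv (twoUnknots.points [(1, 0), (2, 0), (3, 0), (3, 1), (2, 1), (1, 1)])
    (twoUnknots.points [(2, 2), (2, 3)]) <;> decide +kernel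

namespace overlappingUnknots

/-- The states of `overlappingUnknots`. -/
def state (a b : Bool) : overlappingUnknots.State := fun c => if c.1.1 = 2 then a else b

theorem subsingleton_circles_false_false :
    Subsingleton (overlappingUnknots.Circles (state false false)) :=
  subsingleton_circles (overlappingUnknots.points [(1, 0), (2, 0), (3, 0), (4, 0), (5, 0), (5, 1),
    (4, 1), (4, 2), (4, 3), (3, 3), (2, 3), (2, 2), (3, 2), (3, 1), (2, 1), (1, 1)])
    (by decide +kernel) (by decide +kernel)

theorem subsingleton_circles_true_true :
    Subsingleton (overlappingUnknots.Circles (state true true)) :=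
  subsingleton_circles (overlappingUnknots.points [(1, 0), (2, 0), (3, 0), (4, 0), (5, 0), (5, 1),
    (4, 1), (3, 1), (3, 2), (4, 2), (4, 3), (3, 3), (2, 3), (2, 2), (2, 1), (1, 1)])
    (by decide +kernel) (by decide +kernel)

/-- Both crossings are resolved horizontally: a small circle remains between them, inside the strand
interval `1`, `2`, and all else joins into one circle. -/
theorem nonempty_circles_true_false_equiv :
    Nonempty (overlappingUnknots.Circles (state true false) ≃ Unit ⊕ Unit) := by
  apply nonempty_circles_equiv (overlappingUnknots.points [(1, 0), (2, 0), (3, 0), (4, 0), (5, 0),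
    (5, 1), (4, 1), (4, 2), (4, 3), (3, 3), (2, 3), (2, 2), (2, 1), (1, 1)])
    (overlappingUnknots.points [(3, 1), (3, 2)]) <;> decide +kernel

/-- Both crossings are resolved vertically, which gives back the two original circles. -/
theorem nonempty_circles_false_true_equiv :
    Nonempty (overlappingUnknots.Circles (state false true) ≃ Unit ⊕ Unit) := by
  apply nonempty_circles_equiv (overlappingUnknots.points [(1, 0), (2, 0), (3, 0), (4, 0), (5, 0),
    (5, 1), (4, 1), (3, 1), (2, 1), (1, 1)])
    (overlappingUnknots.points [(2, 2), (3, 2), (4, 2), (4, 3), (3, 3), (2, 3)]) <;> decide +kernel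

theorem eq_state : ∀ s : overlappingUnknots.State, ∃ a b, s = state a b := by decide +kernel

theorem weight_state : ∀ a b, overlappingUnknots.weight (state a b) = a.toNat + b.toNat := by
  decide +kernel

end overlappingUnknots

end LinkDiagram

theorem neg_one_pow_smul_of_eq_zero {R M : Type*} [Ring R] [AddCommGroup M] [Module R M] {n : ℕ}
    (hn : n = 0) (x : M) : (-1 : R) ^ n • x = x := by
  rw [hn, pow_zero, one_smul]

theorem neg_one_pow_smul_of_eq_one {R M : Type*} [Ring R] [AddCommGroup M] [Module R M] {n : ℕ}
    (hn : n = 1) (x : M) : (-1 : R) ^ n • x = -x := by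
  rw [hn, pow_one, neg_one_smul]

namespace AlmostTQFT

variable {R : Type*} [CommRing R] {A : Type*} [AddCommGroup A] [Module R A] (F : AlmostTQFT R A)

/-- The connected genus `0` cobordism is insensitive to relabelling its circles, so the arbitrary
bijections chosen later to identify chain modules with `A` or `A ⊗ A` do not affect the
differential. -/
theorem conj_reindex_sphere {I J I' J' : Type} [Finite I] [Nonempty I] [Finite J] [Nonempty J]
    [Finite I'] [Nonempty I'] [Finite J'] [Nonempty J'] {M N : Type*} [AddCommGroup M]
    [AddCommGroup N] [Module R M] [Module R N] (a : I ≃ I') (b : J ≃ J')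
    (e : (⨂[R] _ : I', A) ≃ₗ[R] M) (f : (⨂[R] _ : J', A) ≃ₗ[R] N) :
    F.conj (PiTensorProduct.reindex R (fun _ => A) a ≪≫ₗ e)
      (PiTensorProduct.reindex R (fun _ => A) b ≪≫ₗ f) (Cob.sphere I J) =
      F.conj e f (Cob.sphere I' J') := by
  have h : F.map (Cob.sphere I J) = (PiTensorProduct.reindex R (fun _ => A) b).symm.toLinearMap ∘ₗ
      F.map (Cob.sphere I' J') ∘ₗ (PiTensorProduct.reindex R (fun _ => A) a).toLinearMap := by
    rw [PiTensorProduct.reindex_symm, ← F.map_cylinder, ← F.map_cylinder, ← F.map_comp,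
      F.map_congr _ _ (Cob.cylinder_comp_sphere a), ← F.map_comp,
      F.map_congr _ _ (Cob.sphere_comp_cylinder b.symm)]
  ext x
  simp [conj, h, -PiTensorProduct.reindex_symm]

end AlmostTQFT

/-! ### The differential of the overlapping circles. -/

namespace LinkDiagram

variable {R : Type*} [CommRing R] {A : Type*} [AddCommGroup A] [Module R A] (F : AlmostTQFT R A)

/-- A single circle on one side forces the surface to be connected, since every component meets both
boundaries. -/
theorem saddle_diffeo_sphere (D : LinkDiagram) (s t : D.State)
    (h : Subsingleton (D.Circles s) ∨ Subsingleton (D.Circles t)) :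
    (D.saddle s t).Diffeo (Cob.sphere _ _) := by
  have : Subsingleton (D.saddle s t).Comp := by
    rcases h with h | h
    · exact (D.saddle s t).inn_surjective.subsingleton
    · exact (D.saddle s t).out_surjective.subsingleton
  exact Cob.diffeo_sphere _ fun _ => rfl

open Classical in
theorem diff_apply (D : LinkDiagram) (i j : ℤ) (x : D.Chain F i)
    (t : {s : D.State // (D.weight s : ℤ) = j}) :
    D.diff F i j x t = ∑ s : {s : D.State // (D.weight s : ℤ) = i}, ∑ c : D.Crossing,
      if s.1 c = false ∧ t.1 = Function.update s.1 c true then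
        (-1 : R) ^ (Finset.univ.filter fun c' : D.Crossing => c' < c ∧ s.1 c' = true).card •
          F.map (D.saddle s.1 t.1) (x s)
      else 0 := by
  simp only [diff, LinearMap.pi_apply, LinearMap.sum_apply]
  refine Finset.sum_congr rfl fun s _ => Finset.sum_congr rfl fun c _ => ?_
  split_ifs <;> rfl

namespace overlappingUnknots

/-- The state `state a b` as a state of degree `i`. -/
def stateOf (a b : Bool) (i : ℤ) (h : ((a.toNat + b.toNat : ℕ) : ℤ) = i) :
    {s : overlappingUnknots.State // (overlappingUnknots.weight s : ℤ) = i} :=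
  ⟨state a b, by rw [weight_state, h]⟩

theorem exists_eq_stateOf {i : ℤ}
    (s : {s : overlappingUnknots.State // (overlappingUnknots.weight s : ℤ) = i}) :
    ∃ a b h, s = stateOf a b i h := by
  obtain ⟨s, hs⟩ := s
  obtain ⟨a, b, rfl⟩ := eq_state s
  exact ⟨a, b, by rw [← weight_state, hs], rfl⟩

theorem sum_crossing {M : Type*} [AddCommMonoid M] (f : overlappingUnknots.Crossing → M) :
    ∑ c, f c = f ⟨(2 : Fin 6), rfl⟩ + f ⟨(3 : Fin 6), rfl⟩ := by
  have : (Finset.univ : Finset overlappingUnknots.Crossing) =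
      {⟨(2 : Fin 6), rfl⟩, ⟨(3 : Fin 6), rfl⟩} := by decide
  rw [this, Finset.sum_pair (by decide)]

theorem sum_degree_zero {M : Type*} [AddCommMonoid M]
    [Fintype {s : overlappingUnknots.State // (overlappingUnknots.weight s : ℤ) = 0}]
    (f : {s : overlappingUnknots.State // (overlappingUnknots.weight s : ℤ) = 0} → M) :
    ∑ s, f s = f (stateOf false false 0 rfl) := by
  refine Fintype.sum_eq_single _ fun s hs => absurd ?_ hs
  obtain ⟨_ | _, _ | _, h, rfl⟩ := exists_eq_stateOf s <;> first | rfl | exact absurd h (by decide)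

theorem sum_degree_one {M : Type*} [AddCommMonoid M]
    [Fintype {s : overlappingUnknots.State // (overlappingUnknots.weight s : ℤ) = 1}]
    (f : {s : overlappingUnknots.State // (overlappingUnknots.weight s : ℤ) = 1} → M) :
    ∑ s, f s = f (stateOf true false 1 rfl) + f (stateOf false true 1 rfl) := by
  classical
  have hne : stateOf true false 1 rfl ≠ stateOf false true 1 rfl := by decide +kernel
  rw [← Finset.sum_pair hne]
  refine (Finset.sum_subset (Finset.subset_univ _) fun s _ hs => absurd ?_ hs).symm
  obtain ⟨_ | _, _ | _, h, rfl⟩ := exists_eq_stateOf s <;>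
    first | exact absurd h (by decide) | simp

theorem diff_zero_true_false (x : overlappingUnknots.Chain F 0) :
    overlappingUnknots.diff F 0 1 x (stateOf true false 1 rfl) =
      F.map (overlappingUnknots.saddle (state false false) (state true false))
        (x (stateOf false false 0 rfl)) := by
  rw [diff_apply, sum_degree_zero, sum_crossing, if_pos (by decide +kernel),
    if_neg (by decide +kernel), add_zero]
  exact neg_one_pow_smul_of_eq_zero (by decide +kernel) _

theorem diff_zero_false_true (x : overlappingUnknots.Chain F 0) :
    overlappingUnknots.diff F 0 1 x (stateOf false true 1 rfl) =
      F.map (overlappingUnknots.saddle (state false false) (state false true))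
        (x (stateOf false false 0 rfl)) := by
  rw [diff_apply, sum_degree_zero, sum_crossing, if_neg (by decide +kernel),
    if_pos (by decide +kernel), zero_add]
  exact neg_one_pow_smul_of_eq_zero (by decide +kernel) _

/-- The minus sign belongs to the upper crossing in the state `state true false`, where the lower
crossing already has its `1`-resolution. -/
theorem diff_one (x : overlappingUnknots.Chain F 1) :
    overlappingUnknots.diff F 1 2 x (stateOf true true 2 rfl) =
      F.map (overlappingUnknots.saddle (state false true) (state true true))
        (x (stateOf false true 1 rfl)) -
      F.map (overlappingUnknots.saddle (state true false) (state true true))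
        (x (stateOf true false 1 rfl)) := by
  rw [diff_apply, sum_degree_one, sum_crossing, sum_crossing, if_neg (by decide +kernel),
    if_pos (by decide +kernel), if_pos (by decide +kernel), if_neg (by decide +kernel),
    zero_add, add_zero, sub_eq_neg_add]
  congr 1
  · exact neg_one_pow_smul_of_eq_one (by decide +kernel) _
  · exact neg_one_pow_smul_of_eq_zero (by decide +kernel) _

end overlappingUnknots

end LinkDiagram

section

variable {R : Type*} [CommRing R] {M : Type*} [AddCommGroup M] [Module R M]

theorem Submodule.nonempty_quotient_submoduleOf_equiv_of_eq_bot {p q : Submodule R M} (hp : p = ⊥) :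
    Nonempty ((q ⧸ p.submoduleOf q) ≃ₗ[R] q) :=
  ⟨Submodule.quotEquivOfEqBot _ (by subst hp; simp [Submodule.submoduleOf])⟩

theorem Submodule.nonempty_quotient_submoduleOf_equiv_of_eq_top {p q : Submodule R M} (hq : q = ⊤) :
    Nonempty ((q ⧸ p.submoduleOf q) ≃ₗ[R] M ⧸ p) :=
  ⟨Submodule.Quotient.equiv _ _ (LinearEquiv.ofTop q hq) (by
    subst hq
    ext x
    simp [Submodule.submoduleOf])⟩

end

theorem exists_pi_eq_and_eq {ι : Type*} {M : ι → Type*} {i j : ι} (hij : i ≠ j) (x : ∀ k, M k)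
    (u : M i) (v : M j) : ∃ y : ∀ k, M k, y i = u ∧ y j = v := by
  classical
  exact ⟨Function.update (Function.update x i u) j v, by simp [hij], by simp⟩

/-! ### The homology of the two circles and the complex of the overlapping ones. -/

namespace LinkDiagram

variable {R : Type*} [CommRing R] {A : Type*} [AddCommGroup A] [Module R A] (F : AlmostTQFT R A)

section Homology

variable (D : LinkDiagram) {h i j : ℤ} {B : Type*} [AddCommGroup B] [Module R B]

/-- Replaces the degrees `i - 1` and `i + 1` in `Homology` by variables, so that they can be
instantiated with numerals. -/
theorem nonempty_quotient_equiv_of_homology (e : Nonempty (D.Homology F i ≃ₗ[R] B)) (hh : h = i - 1)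
    (hj : j = i + 1) : Nonempty ((LinearMap.ker (D.diff F i j) ⧸
      (LinearMap.range (D.diff F h i)).submoduleOf (LinearMap.ker (D.diff F i j))) ≃ₗ[R] B) := by
  subst hh hj
  exact e

theorem ker_le_range_of_subsingleton_homology (e : Subsingleton (D.Homology F i)) (hh : h = i - 1)
    (hj : j = i + 1) : LinearMap.ker (D.diff F i j) ≤ LinearMap.range (D.diff F h i) := by
  subst hh hj
  exact Submodule.submoduleOf_eq_top.1 (Submodule.Quotient.subsingleton_iff.1 e)

theorem ker_diff_eq_top [Subsingleton (D.Chain F j)] : LinearMap.ker (D.diff F i j) = ⊤ :=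
  LinearMap.ker_eq_top.2 (LinearMap.ext fun _ => Subsingleton.elim _ _)

theorem range_diff_eq_bot [Subsingleton (D.Chain F h)] : LinearMap.range (D.diff F h i) = ⊥ :=
  LinearMap.range_eq_bot.2 (LinearMap.ext fun x => by
    rw [Subsingleton.elim x 0, map_zero, map_zero])

theorem subsingleton_homology [Subsingleton (D.Chain F i)] : Subsingleton (D.Homology F i) :=
  Quot.Subsingleton

end Homology

section TwoUnknots

theorem weight_twoUnknots (s : twoUnknots.State) : twoUnknots.weight s = 0 := by
  simp [weight]

theorem subsingleton_chain_twoUnknots {i : ℤ} (hi : i ≠ 0) :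
    Subsingleton (twoUnknots.Chain F i) := by
  have : IsEmpty {s : twoUnknots.State // (twoUnknots.weight s : ℤ) = i} :=
    ⟨fun s => hi (by rw [← s.2, weight_twoUnknots]; rfl)⟩
  infer_instance

theorem nonempty_homology_twoUnknots_equiv :
    Nonempty (twoUnknots.Homology F 0 ≃ₗ[R] A ⊗[R] A) := by
  have := subsingleton_chain_twoUnknots F (i := 0 + 1) (by decide)
  have := subsingleton_chain_twoUnknots F (i := 0 - 1) (by decide)
  obtain ⟨e1⟩ := Submodule.nonempty_quotient_submoduleOf_equiv_of_eq_bot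
    (q := LinearMap.ker (twoUnknots.diff F 0 (0 + 1))) (range_diff_eq_bot F twoUnknots
      (h := 0 - 1) (i := 0))
  let e2 := LinearEquiv.ofTop _ (ker_diff_eq_top F twoUnknots (i := 0) (j := 0 + 1))
  let _ : Unique {s : twoUnknots.State // (twoUnknots.weight s : ℤ) = 0} :=
    { default := ⟨fun _ => false, by rw [weight_twoUnknots]; rfl⟩
      uniq := fun s => Subsingleton.elim _ _ }
  obtain ⟨e3⟩ := nonempty_circles_twoUnknots_equiv fun _ => false
  exact ⟨e1 ≪≫ₗ e2 ≪≫ₗ LinearEquiv.piUnique R (fun s : {s : twoUnknots.State //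
    (twoUnknots.weight s : ℤ) = 0} => ⨂[R] _ : twoUnknots.Circles s.1, A) ≪≫ₗ
    PiTensorProduct.reindex R (fun _ => A) e3 ≪≫ₗ AlmostTQFT.twoCircles R A⟩

end TwoUnknots

namespace overlappingUnknots

theorem subsingleton_chain {i : ℤ} (h0 : i ≠ 0) (h1 : i ≠ 1) (h2 : i ≠ 2) :
    Subsingleton (overlappingUnknots.Chain F i) := by
  have : IsEmpty {s : overlappingUnknots.State // (overlappingUnknots.weight s : ℤ) = i} :=
    ⟨fun s => by
      obtain ⟨_ | _, _ | _, h, -⟩ := exists_eq_stateOf s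
      exacts [h0 h.symm, h1 h.symm, h1 h.symm, h2 h.symm]⟩
  infer_instance

theorem nonempty_circles_equiv_unit {s : overlappingUnknots.State}
    (h : Subsingleton (overlappingUnknots.Circles s)) :
    Nonempty (overlappingUnknots.Circles s ≃ Unit) :=
  let _ : Unique (overlappingUnknots.Circles s) := uniqueOfSubsingleton (Classical.arbitrary _)
  ⟨Equiv.equivPUnit _⟩

variable (R A) in
/-- The value on the circle of a state with a single circle. -/
noncomputable def valueOne {s : overlappingUnknots.State}
    (h : Subsingleton (overlappingUnknots.Circles s)) :
    (⨂[R] _ : overlappingUnknots.Circles s, A) ≃ₗ[R] A :=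
  PiTensorProduct.reindex R (fun _ => A) (nonempty_circles_equiv_unit h).some ≪≫ₗ
    AlmostTQFT.oneCircle R A

variable (R A) in
/-- The value on the circles of a state with two circles. -/
noncomputable def valueTwo {s : overlappingUnknots.State}
    (h : Nonempty (overlappingUnknots.Circles s ≃ Unit ⊕ Unit)) :
    (⨂[R] _ : overlappingUnknots.Circles s, A) ≃ₗ[R] A ⊗[R] A :=
  PiTensorProduct.reindex R (fun _ => A) h.some ≪≫ₗ AlmostTQFT.twoCircles R A

theorem valueTwo_map_saddle {s t : overlappingUnknots.State}
    (hs : Subsingleton (overlappingUnknots.Circles s))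
    (ht : Nonempty (overlappingUnknots.Circles t ≃ Unit ⊕ Unit)) (x) :
    valueTwo R A ht (F.map (overlappingUnknots.saddle s t) x) = F.comul (valueOne R A hs x) := by
  rw [F.map_congr _ _ (saddle_diffeo_sphere _ s t (Or.inl hs)), AlmostTQFT.comul_eq_conj,
    ← F.conj_reindex_sphere (nonempty_circles_equiv_unit hs).some ht.some]
  simp [AlmostTQFT.conj, valueOne, valueTwo, -PiTensorProduct.reindex_symm]

theorem valueOne_map_saddle {s t : overlappingUnknots.State}
    (hs : Nonempty (overlappingUnknots.Circles s ≃ Unit ⊕ Unit))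
    (ht : Subsingleton (overlappingUnknots.Circles t)) (x) :
    valueOne R A ht (F.map (overlappingUnknots.saddle s t) x) = F.mul (valueTwo R A hs x) := by
  rw [F.map_congr _ _ (saddle_diffeo_sphere _ s t (Or.inr ht)), AlmostTQFT.mul_eq_conj,
    ← F.conj_reindex_sphere hs.some (nonempty_circles_equiv_unit ht).some]
  simp [AlmostTQFT.conj, valueOne, valueTwo, -PiTensorProduct.reindex_symm]

/-- The chain module in degree `0`. -/
noncomputable def chainZero : overlappingUnknots.Chain F 0 ≃ₗ[R] A :=
  LinearEquiv.ofBijective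
    ((valueOne R A subsingleton_circles_false_false).toLinearMap ∘ₗ
      LinearMap.proj (stateOf false false 0 rfl)) <| by
    refine (valueOne R A subsingleton_circles_false_false).bijective.comp
      ⟨fun x y hxy => funext fun s => ?_, Function.surjective_eval _⟩
    obtain ⟨_ | _, _ | _, h, rfl⟩ := exists_eq_stateOf s
    exacts [hxy, absurd h (by decide), absurd h (by decide), absurd h (by decide)]

/-- The chain module in degree `2`. -/
noncomputable def chainTwo : overlappingUnknots.Chain F 2 ≃ₗ[R] A :=
  LinearEquiv.ofBijective
    ((valueOne R A subsingleton_circles_true_true).toLinearMap ∘ₗ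
      LinearMap.proj (stateOf true true 2 rfl)) <| by
    refine (valueOne R A subsingleton_circles_true_true).bijective.comp
      ⟨fun x y hxy => funext fun s => ?_, Function.surjective_eval _⟩
    obtain ⟨_ | _, _ | _, h, rfl⟩ := exists_eq_stateOf s
    exacts [absurd h (by decide), absurd h (by decide), absurd h (by decide), hxy]

/-- The chain module in degree `1`. -/
noncomputable def chainOne : overlappingUnknots.Chain F 1 ≃ₗ[R] (A ⊗[R] A) × (A ⊗[R] A) :=
  LinearEquiv.ofBijective
    (((valueTwo R A nonempty_circles_true_false_equiv).toLinearMap ∘ₗ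
      LinearMap.proj (stateOf true false 1 rfl)).prod
    ((valueTwo R A nonempty_circles_false_true_equiv).toLinearMap ∘ₗ
      LinearMap.proj (stateOf false true 1 rfl))) <| by
    refine ⟨fun x y hxy => funext fun s => ?_, fun ⟨y, z⟩ => ?_⟩
    · obtain ⟨h1, h2⟩ := Prod.ext_iff.1 hxy
      obtain ⟨_ | _, _ | _, h, rfl⟩ := exists_eq_stateOf s
      exacts [absurd h (by decide),
        (valueTwo R A nonempty_circles_false_true_equiv).injective h2,
        (valueTwo R A nonempty_circles_true_false_equiv).injective h1, absurd h (by decide)]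
    · have hne : stateOf true false 1 rfl ≠ stateOf false true 1 rfl := by decide +kernel
      obtain ⟨x, h1, h2⟩ := exists_pi_eq_and_eq hne
        (0 : overlappingUnknots.Chain F 1)
        ((valueTwo R A nonempty_circles_true_false_equiv).symm y)
        ((valueTwo R A nonempty_circles_false_true_equiv).symm z)
      exact ⟨x, Prod.ext
        ((congrArg (valueTwo R A nonempty_circles_true_false_equiv) h1).trans
          (LinearEquiv.apply_symm_apply _ y))
        ((congrArg (valueTwo R A nonempty_circles_false_true_equiv) h2).trans
          (LinearEquiv.apply_symm_apply _ z))⟩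

/-- Both saddles split the single circle of the initial state, and both carry the sign `+`. -/
theorem chainOne_diff (x : overlappingUnknots.Chain F 0) :
    chainOne F (overlappingUnknots.diff F 0 1 x) =
      (F.comul (chainZero F x), F.comul (chainZero F x)) := by
  refine Prod.ext ?_ ?_
  · change valueTwo R A _ (overlappingUnknots.diff F 0 1 x (stateOf true false 1 rfl)) = _
    rw [diff_zero_true_false]
    exact valueTwo_map_saddle F subsingleton_circles_false_false _ _
  · change valueTwo R A _ (overlappingUnknots.diff F 0 1 x (stateOf false true 1 rfl)) = _
    rw [diff_zero_false_true]
    exact valueTwo_map_saddle F subsingleton_circles_false_false _ _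

/-- Both saddles merge two circles into the single circle of the final state, with opposite signs.
-/
theorem chainTwo_diff (x : overlappingUnknots.Chain F 1) :
    chainTwo F (overlappingUnknots.diff F 1 2 x) =
      F.mul (chainOne F x).2 - F.mul (chainOne F x).1 := by
  change valueOne R A subsingleton_circles_true_true (overlappingUnknots.diff F 1 2 x (stateOf true true 2 rfl)) = _
  rw [diff_one, map_sub]
  exact congrArg₂ _ (valueOne_map_saddle F nonempty_circles_false_true_equiv _ _)
    (valueOne_map_saddle F nonempty_circles_true_false_equiv _ _)

theorem diff_comp_diff :
    overlappingUnknots.diff F 1 2 ∘ₗ overlappingUnknots.diff F 0 1 = 0 := by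
  refine LinearMap.ext fun x => (chainTwo F).injective ?_
  rw [LinearMap.comp_apply, chainTwo_diff, chainOne_diff, sub_self, LinearMap.zero_apply, map_zero]

end overlappingUnknots

end LinkDiagram

/-! ### Comparison of ranks and the conclusion. -/

namespace AlmostTQFT

variable {R : Type*} [CommRing R] {A : Type*} [AddCommGroup A] [Module R A] (F : AlmostTQFT R A)

open LinkDiagram overlappingUnknots

/-- The degree `k` is the unknown shift of the move, because the two circles have homology in degree
`0` only. -/
theorem exists_homology_overlappingUnknots (hF : F.IsInvariantRII) :
    ∃ k : ℤ, Nonempty (overlappingUnknots.Homology F k ≃ₗ[R] A ⊗[R] A) ∧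
      ∀ i ≠ k, Subsingleton (overlappingUnknots.Homology F i) := by
  obtain ⟨k, h⟩ := hF _ _ reidemeisterII_twoUnknots
  refine ⟨k, ?_, fun i hi => ?_⟩
  · obtain ⟨e⟩ := h 0
    obtain ⟨e'⟩ := nonempty_homology_twoUnknots_equiv F
    rw [zero_add] at e
    exact ⟨e.symm ≪≫ₗ e'⟩
  · obtain ⟨e⟩ := h (i - k)
    rw [sub_add_cancel] at e
    have := subsingleton_chain_twoUnknots F (sub_ne_zero.2 hi)
    have := subsingleton_homology F twoUnknots (i := i - k)
    exact e.symm.subsingleton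

theorem surjective_diff_one (h : Subsingleton (overlappingUnknots.Homology F 2)) :
    Function.Surjective (overlappingUnknots.diff F 1 2) := by
  have := subsingleton_chain F (i := 3) (by decide) (by decide) (by decide)
  have h1 := ker_le_range_of_subsingleton_homology F _ h (h := 1) (j := 3) rfl rfl
  rw [ker_diff_eq_top] at h1
  exact LinearMap.range_eq_top.1 (top_le_iff.1 h1)

theorem injective_diff_zero (h : Subsingleton (overlappingUnknots.Homology F 0)) :
    Function.Injective (overlappingUnknots.diff F 0 1) := by
  have := subsingleton_chain F (i := -1) (by decide) (by decide) (by decide)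
  have h1 := ker_le_range_of_subsingleton_homology F _ h (h := -1) (j := 1) rfl rfl
  rw [range_diff_eq_bot] at h1
  exact LinearMap.ker_eq_bot.1 (le_bot_iff.1 h1)

/-- A comparison of ranks excludes every degree but `1` for the homology; there the complex splits
at both ends. -/
theorem split_of_isInvariantRII [Module.Finite R A] [Module.Free R A] [Nontrivial A]
    (hF : F.IsInvariantRII) : Module.finrank R A = 2 ∧
      Function.Surjective (overlappingUnknots.diff F 1 2) ∧
      ∃ r : overlappingUnknots.Chain F 1 →ₗ[R] overlappingUnknots.Chain F 0,
        ∀ x, r (overlappingUnknots.diff F 0 1 x) = x := by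
  have : Nontrivial R := Module.nontrivial R A
  have hpos : 0 < Module.finrank R A := Module.finrank_pos_iff_of_free R A |>.2 ‹_›
  have hAA : Module.finrank R (A ⊗[R] A) = Module.finrank R A * Module.finrank R A :=
    Module.finrank_tensorProduct ..
  have : Module.Free R (overlappingUnknots.Chain F 0) := Module.Free.of_equiv (chainZero F).symm
  have : Module.Free R (overlappingUnknots.Chain F 1) := Module.Free.of_equiv (chainOne F).symm
  have : Module.Free R (overlappingUnknots.Chain F 2) := Module.Free.of_equiv (chainTwo F).symm
  have : Module.Finite R (overlappingUnknots.Chain F 0) := Module.Finite.equiv (chainZero F).symm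
  have : Module.Finite R (overlappingUnknots.Chain F 1) := Module.Finite.equiv (chainOne F).symm
  have : Module.Finite R (overlappingUnknots.Chain F 2) := Module.Finite.equiv (chainTwo F).symm
  have h0 := (chainZero F).finrank_eq
  have h1 := (chainOne F).finrank_eq
  have h2 := (chainTwo F).finrank_eq
  rw [Module.finrank_prod, hAA] at h1
  generalize Module.finrank R A = n at *
  obtain ⟨k, he, hs⟩ := F.exists_homology_overlappingUnknots hF
  by_cases hk1 : k = 1
  · subst hk1
    have hsurj := F.surjective_diff_one (hs 2 (by decide))
    obtain ⟨e⟩ := nonempty_quotient_equiv_of_homology F _ he (h := 0) (j := 2) rfl rfl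
    obtain ⟨hr, ⟨e⟩⟩ := split_of_homology_middle (diff_comp_diff F)
      (F.injective_diff_zero (hs 0 (by decide))) hsurj e
    refine ⟨?_, hsurj, hr⟩
    -- Here `2n² = (n + n²) + n`, whence `n = 2` as `n > 0`.
    have := e.finrank_eq
    rw [Module.finrank_prod, Module.finrank_prod, hAA, h0, h1, h2] at this
    nlinarith
  exfalso
  have hexact := ker_le_range_of_subsingleton_homology F _ (hs 1 (Ne.symm hk1)) (h := 0) (j := 2)
    rfl rfl
  by_cases hk0 : k = 0
  · subst hk0
    have := subsingleton_chain F (i := -1) (by decide) (by decide) (by decide)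
    obtain ⟨e⟩ := nonempty_quotient_equiv_of_homology F _ he (h := -1) (j := 1) rfl rfl
    obtain ⟨e'⟩ := Submodule.nonempty_quotient_submoduleOf_equiv_of_eq_bot
      (q := LinearMap.ker (overlappingUnknots.diff F 0 1))
      (range_diff_eq_bot F overlappingUnknots (h := -1) (i := 0))
    obtain ⟨e⟩ := split_of_homology_left (diff_comp_diff F) hexact
      (F.surjective_diff_one (hs 2 (by decide))) (e'.symm ≪≫ₗ e)
    -- Here `n + n = n² + 2n²`, impossible for `n > 0`.
    have := e.finrank_eq
    rw [Module.finrank_prod, Module.finrank_prod, hAA, h0, h1, h2] at this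
    nlinarith
  by_cases hk2 : k = 2
  · subst hk2
    have := subsingleton_chain F (i := 3) (by decide) (by decide) (by decide)
    obtain ⟨e⟩ := nonempty_quotient_equiv_of_homology F _ he (h := 1) (j := 3) rfl rfl
    obtain ⟨e'⟩ := Submodule.nonempty_quotient_submoduleOf_equiv_of_eq_top
      (p := LinearMap.range (overlappingUnknots.diff F 1 2))
      (ker_diff_eq_top F overlappingUnknots (i := 2) (j := 3))
    obtain ⟨e⟩ := split_of_homology_right (diff_comp_diff F)
      (F.injective_diff_zero (hs 0 (by decide))) hexact (e'.symm ≪≫ₗ e)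
    -- Again `2n² + n² = n + n`.
    have := e.finrank_eq
    rw [Module.finrank_prod, Module.finrank_prod, hAA, h0, h1, h2] at this
    nlinarith
  -- Outside degrees `0`, `1`, `2` the complex is zero, so `A ⊗ A` would vanish, against `n > 0`.
  have := subsingleton_chain F hk0 hk1 hk2
  have := subsingleton_homology F overlappingUnknots (i := k)
  obtain ⟨e⟩ := he
  have := e.symm.subsingleton
  rw [Module.finrank_zero_of_subsingleton] at hAA
  nlinarith

end AlmostTQFT

open LinkDiagram overlappingUnknots in
theorem AlmostTQFT.surjective_mul_and_exists_retraction_comul {R : Type*} [CommRing R] {A : Type*}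
    [AddCommGroup A] [Module R A] (F : AlmostTQFT R A)
    (hsurj : Function.Surjective (overlappingUnknots.diff F 1 2))
    (hr : ∃ r : overlappingUnknots.Chain F 1 →ₗ[R] overlappingUnknots.Chain F 0,
        ∀ x, r (overlappingUnknots.diff F 0 1 x) = x) :
    Function.Surjective F.mul ∧ ∃ r : A ⊗[R] A →ₗ[R] A, r ∘ₗ F.comul = LinearMap.id := by
  obtain ⟨r, hr⟩ := hr
  -- As `d⁰ a = (Δ a, Δ a)`, a retraction of `d⁰` composed with the diagonal `t ↦ (t, t)` of `A ⊗ A`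
  -- is a retraction of `Δ`.
  refine ⟨fun a => ?_, ⟨(chainZero F).toLinearMap ∘ₗ r ∘ₗ (chainOne F).symm.toLinearMap ∘ₗ
    LinearMap.id.prod LinearMap.id, ?_⟩⟩
  · obtain ⟨x, hx⟩ := hsurj ((chainTwo F).symm a)
    refine ⟨(chainOne F x).2 - (chainOne F x).1, ?_⟩
    rw [map_sub, ← chainTwo_diff, hx, LinearEquiv.apply_symm_apply]
  · ext a
    obtain ⟨x, rfl⟩ := (chainZero F).surjective a
    change chainZero F (r ((chainOne F).symm (F.comul _, F.comul _))) = _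
    rw [← chainOne_diff, LinearEquiv.symm_apply_apply, hr]
    rfl

theorem mainTheorem9 {R : Type*} [CommRing R] {A : Type*} [AddCommGroup A] [Module R A]
    [Module.Finite R A] [Module.Free R A] (F : AlmostTQFT R A) (hF : F.IsInvariantRII) :
    IsFrobenius R F.mul F.comul ∧ Function.Surjective F.mul ∧ Function.Injective F.comul ∧
      (Nontrivial A → Module.finrank R A = 2) := by
  have hA := F.isNearlyFrobenius
  -- The comparison of ranks needs `n > 0`; for `A = 0` everything holds with zero unit and counit.
  rcases subsingleton_or_nontrivial A with h | h
  · exact ⟨{ hA with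
      exists_unit := ⟨0, fun _ => ⟨Subsingleton.elim _ _, Subsingleton.elim _ _⟩⟩
      exists_counit := ⟨0, fun _ => ⟨Subsingleton.elim _ _, Subsingleton.elim _ _⟩⟩ },
      fun _ => ⟨0, Subsingleton.elim _ _⟩, Function.injective_of_subsingleton _,
      fun h' => absurd h (not_subsingleton_iff_nontrivial.2 h')⟩
  · obtain ⟨hrank, hsurj, hr⟩ := F.split_of_isInvariantRII hF
    obtain ⟨hm, r, hr⟩ := F.surjective_mul_and_exists_retraction_comul hsurj hr
    exact ⟨{ hA with
      exists_unit := hA.exists_unit hm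
      exists_counit := hA.exists_counit r hr }, hm,
      Function.LeftInverse.injective (LinearMap.congr_fun hr), fun _ => hrank⟩
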